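/- **Theorem 3.12 (Existence of an optimizer for $F_{\mathrm L}$).** Let $M,N$ be natural numbers, $\boldsymbol\Lambda\in\mathbb R^{M\times N}$ and $\mathbf t\in\mathbb R^N$ with $\mathbf t\neq\mathbf 0$. On $\mathcal H=L^2(\mathbb R^M,\mathbb C^{2^N})$, $\mathbb C^{2^N}=\bigotimes^N\mathbb C^2$, let $\sigma_a^n$ ($a\in\{x,z\}$) be the Pauli matrix $\sigma_a$ acting on the $n$-th tensor factor, and consider the multi-mode Dicke Hamiltonian $$\mathbf H_0=\sum_{m=1}^M(-\partial_{x_m}^2+x_m^2)+\sum_{m=1}^M\sum_{n=1}^N x_m\Lambda_{mn}\sigma_z^n-\sum_{n=1}^N t_n\sigma_x^n ,$$ whose form domain is $Q_0=\{\boldsymbol\psi\in\mathcal H:\nabla\boldsymbol\psi\in L^2,\ |\mathbf x|\boldsymbol\psi\in L^2\}$; $\langle\boldsymbol\psi,\mathbf H_0\boldsymbol\psi\rangle$ denotes its quadratic form. Let $\mathcal D(Q_0)$ be the set of operators $\boldsymbol\Gamma=\sum_j c_j|\boldsymbol\psi_j\rangle\langle\boldsymbol\psi_j|$ on $\mathcal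 H$ (finite or countable sums) with $c_j\ge 0$, $\sum_j c_j=1$, $\boldsymbol\psi_j\in Q_0$ orthonormal in $\mathcal H$, and $\sum_j c_j\big(\|\nabla\boldsymbol\psi_j\|^2+\|\mathbf x\boldsymbol\psi_j\|^2\big)<\infty$. For such $\boldsymbol\Gamma$ put $$\boldsymbol\sigma_{\boldsymbol\Gamma}=\big(\operatorname{Tr}\sigma_z^n\boldsymbol\Gamma\big)_{n=1}^N=\Big(\sum_j c_j\langle\boldsymbol\psi_j,\sigma_z^n\boldsymbol\psi_j\rangle\Big)_{n=1}^N,\qquad \boldsymbol\xi_{\boldsymbol\Gamma}=\sum_j c_j\int_{\mathbb R^M}\mathbf x\,|\boldsymbol\psi_j(\mathbf x)|^2\,d\mathbf x,\qquad \operatorname{Tr}(\mathbf H_0\boldsymbol\Gamma)=\sum_j c_j\langle\boldsymbol\psi_j,\mathbf H_0\boldsymbol\psi_j\rangle ;$$ these do not depend on the chosen decomposition of $\boldsymbol\Gamma$. For $(\boldsymbol\sigma,\boldsymbol\xi)\in\mathbb R^N\times\mathbb R^M$ define the Lieb functional $$F_{\mathrm L}(\boldsymbol\sigma,\boldsymbol\xi)=\inf\{\operatorname{Tr}(\mathbf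 H_0\boldsymbol\Gamma):\boldsymbol\Gamma\in\mathcal D(Q_0),\ \boldsymbol\sigma_{\boldsymbol\Gamma}=\boldsymbol\sigma,\ \boldsymbol\xi_{\boldsymbol\Gamma}=\boldsymbol\xi\}\in[-\infty,+\infty],\qquad \inf\emptyset=+\infty .$$ Then for every $(\boldsymbol\sigma,\boldsymbol\xi)\in[-1,1]^N\times\mathbb R^M$ there exists $\boldsymbol\Gamma\in\mathcal D(Q_0)$ such that $\boldsymbol\sigma_{\boldsymbol\Gamma}=\boldsymbol\sigma$, $\boldsymbol\xi_{\boldsymbol\Gamma}=\boldsymbol\xi$ and $F_{\mathrm L}(\boldsymbol\sigma,\boldsymbol\xi)=\operatorname{Tr}(\mathbf H_0\boldsymbol\Gamma)$. In particular $F_{\mathrm L}(\boldsymbol\sigma,\boldsymbol\xi)$ is finite. -/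

import Mathlib

open MeasureTheory
open scoped InnerProductSpace SchwartzMap LineDeriv

noncomputable section

namespace Dicke

/-! ### The Hilbert space and the lifted Pauli matrices -/

/-- The configuration space `ℝ^M` of the `M` modes. -/
abbrev Pos (M : ℕ) : Type := EuclideanSpace ℝ (Fin M)

/-- The space `ℂ^{2^N}` of the `N` two-level systems. A multi-index `α : Fin N → Fin 2` stands
for a sign vector in `{+,-}^N`, with `0` for `+` and `1` for `-`. -/
abbrev Spin (N : ℕ) : Type := EuclideanSpace ℂ (Fin N → Fin 2)

/-- The Hilbert space `L²(ℝ^M, ℂ^{2^N})`. -/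
abbrev Hil (M N : ℕ) : Type := Lp (Spin N) 2 (volume : Measure (Pos M))

/-- The Pauli matrix `σ_x`. -/
def pauliX : Matrix (Fin 2) (Fin 2) ℂ := !![0, 1; 1, 0]

/-- The Pauli matrix `σ_z`. -/
def pauliZ : Matrix (Fin 2) (Fin 2) ℂ := !![1, 0; 0, -1]

/-- The tensor product `1 ⊗ ⋯ ⊗ 1 ⊗ A ⊗ 1 ⊗ ⋯ ⊗ 1` with the `2 × 2` matrix `A` in the `n`-th
place. -/
def lift {N : ℕ} (n : Fin N) (A : Matrix (Fin 2) (Fin 2) ℂ) :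
    Matrix (Fin N → Fin 2) (Fin N → Fin 2) ℂ :=
  Matrix.of fun α β => ∏ k, (if k = n then A else 1) (α k) (β k)

/-- A matrix on `ℂ^{2^N}` acting pointwise on `L²(ℝ^M, ℂ^{2^N})`. -/
def spinOp (M : ℕ) {N : ℕ} (A : Matrix (Fin N → Fin 2) (Fin N → Fin 2) ℂ) :
    Hil M N →L[ℂ] Hil M N :=
  (Matrix.toEuclideanCLM (n := Fin N → Fin 2) (𝕜 := ℂ) A).compLpL 2 volume

/-- The operator `σ_x^n`. -/
def sigmaX (M : ℕ) {N : ℕ} (n : Fin N) : Hil M N →L[ℂ] Hil M N := spinOp M (lift n pauliX)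

/-- The operator `σ_z^n`. -/
def sigmaZ (M : ℕ) {N : ℕ} (n : Fin N) : Hil M N →L[ℂ] Hil M N := spinOp M (lift n pauliZ)

/-! ### The form domain of the Hamiltonian -/

/-- The function `g ∈ L²` is the distributional partial derivative `∂_m ψ` of `ψ ∈ L²`. -/
def IsPartial {M N : ℕ} (m : Fin M) (ψ g : Hil M N) : Prop :=
  ∂_{(EuclideanSpace.single m (1 : ℝ) : Pos M)} (ψ : 𝓢'(Pos M, Spin N)) = (g : 𝓢'(Pos M, Spin N))

lemma toTemperedDistribution_injective {M N : ℕ} {f g : Hil M N}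
    (h : (f : 𝓢'(Pos M, Spin N)) = (g : 𝓢'(Pos M, Spin N))) : f = g :=
  LinearMap.ker_eq_bot.mp
    (Lp.ker_toTemperedDistributionCLM_eq_bot (F := Spin N) (μ := (volume : Measure (Pos M)))
      (p := 2)) h

lemma IsPartial.unique {M N : ℕ} {m : Fin M} {ψ g g' : Hil M N} (h : IsPartial m ψ g)
    (h' : IsPartial m ψ g') : g = g' :=
  toTemperedDistribution_injective (h.symm.trans h')

lemma IsPartial.add {M N : ℕ} {m : Fin M} {ψ χ g g' : Hil M N} (h : IsPartial m ψ g)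
    (h' : IsPartial m χ g') : IsPartial m (ψ + χ) (g + g') := by
  have e : ∀ a b : Hil M N, ((a + b : Hil M N) : 𝓢'(Pos M, Spin N)) = a + b := fun a b =>
    map_add (Lp.toTemperedDistributionCLM (Spin N) (volume : Measure (Pos M)) 2) a b
  unfold IsPartial at *
  rw [e, e, LineDeriv.lineDerivOp_add, h, h']

lemma IsPartial.smul {M N : ℕ} {m : Fin M} {ψ g : Hil M N} (a : ℂ) (h : IsPartial m ψ g) :
    IsPartial m (a • ψ) (a • g) := by
  have e : ∀ b : Hil M N, ((a • b : Hil M N) : 𝓢'(Pos M, Spin N)) = a • (b : 𝓢'(Pos M, Spin N)) :=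
    fun b => map_smul (Lp.toTemperedDistributionCLM (Spin N) (volume : Measure (Pos M)) 2) a b
  unfold IsPartial at *
  rw [e, e, LineDeriv.lineDerivOp_smul, h]

/-- The function `g ∈ L²` is the product `x_m ψ`. -/
def IsMulPos {M N : ℕ} (m : Fin M) (ψ g : Hil M N) : Prop :=
  ∀ᵐ x : Pos M, g x = ((x m : ℝ) : ℂ) • ψ x

lemma IsMulPos.unique {M N : ℕ} {m : Fin M} {ψ g g' : Hil M N} (h : IsMulPos m ψ g)
    (h' : IsMulPos m ψ g') : g = g' := by
  refine Lp.ext ?_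
  filter_upwards [h, h'] with x hx hx'
  rw [hx, hx']

lemma IsMulPos.add {M N : ℕ} {m : Fin M} {ψ χ g g' : Hil M N} (h : IsMulPos m ψ g)
    (h' : IsMulPos m χ g') : IsMulPos m (ψ + χ) (g + g') := by
  filter_upwards [h, h', Lp.coeFn_add ψ χ, Lp.coeFn_add g g'] with x h1 h2 h3 h4
  rw [h4, h3, Pi.add_apply, Pi.add_apply, h1, h2, smul_add]

lemma IsMulPos.smul {M N : ℕ} {m : Fin M} {ψ g : Hil M N} (a : ℂ) (h : IsMulPos m ψ g) :
    IsMulPos m (a • ψ) (a • g) := by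
  filter_upwards [h, Lp.coeFn_smul a ψ, Lp.coeFn_smul a g] with x h1 h2 h3
  rw [h3, h2, Pi.smul_apply, Pi.smul_apply, h1, smul_comm]

/-- The form domain `Q₀` of the Hamiltonian: all `ψ ∈ L²(ℝ^M, ℂ^{2^N})` with `∇ψ ∈ L²` and
`|x| ψ ∈ L²`. -/
def formDomain (M N : ℕ) : Submodule ℂ (Hil M N) where
  carrier := {ψ | ∀ m : Fin M, (∃ g, IsPartial m ψ g) ∧ ∃ g, IsMulPos m ψ g}
  add_mem' {ψ χ} hψ hχ m := by
    obtain ⟨⟨g, hg⟩, k, hk⟩ := hψ m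
    obtain ⟨⟨g', hg'⟩, k', hk'⟩ := hχ m
    exact ⟨⟨_, hg.add hg'⟩, _, hk.add hk'⟩
  zero_mem' m := by
    have e : ((0 : Hil M N) : 𝓢'(Pos M, Spin N)) = 0 :=
      map_zero (Lp.toTemperedDistributionCLM (Spin N) (volume : Measure (Pos M)) 2)
    refine ⟨⟨0, ?_⟩, 0, ?_⟩
    · unfold IsPartial
      rw [e, LineDeriv.lineDerivOp_zero]
    · filter_upwards [Lp.coeFn_zero (Spin N) 2 (volume : Measure (Pos M))] with x hx
      rw [hx, Pi.zero_apply, smul_zero]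
  smul_mem' a ψ hψ m := by
    obtain ⟨⟨g, hg⟩, k, hk⟩ := hψ m
    exact ⟨⟨_, hg.smul a⟩, _, hk.smul a⟩

/-- The partial derivative `∂_m : Q₀ → L²`. -/
def partialD {M N : ℕ} (m : Fin M) : formDomain M N →ₗ[ℂ] Hil M N where
  toFun ψ := (ψ.2 m).1.choose
  map_add' ψ χ := (((ψ + χ).2 m).1.choose_spec).unique
    ((ψ.2 m).1.choose_spec.add (χ.2 m).1.choose_spec)
  map_smul' a ψ := (((a • ψ).2 m).1.choose_spec).unique ((ψ.2 m).1.choose_spec.smul a)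

lemma isPartial_partialD {M N : ℕ} (m : Fin M) (ψ : formDomain M N) :
    IsPartial m (ψ : Hil M N) (partialD m ψ) :=
  (ψ.2 m).1.choose_spec

/-- Multiplication by the coordinate `x_m`, as a map `Q₀ → L²`. -/
def mulPos {M N : ℕ} (m : Fin M) : formDomain M N →ₗ[ℂ] Hil M N where
  toFun ψ := (ψ.2 m).2.choose
  map_add' ψ χ := (((ψ + χ).2 m).2.choose_spec).unique
    ((ψ.2 m).2.choose_spec.add (χ.2 m).2.choose_spec)
  map_smul' a ψ := (((a • ψ).2 m).2.choose_spec).unique ((ψ.2 m).2.choose_spec.smul a)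

lemma isMulPos_mulPos {M N : ℕ} (m : Fin M) (ψ : formDomain M N) :
    IsMulPos m (ψ : Hil M N) (mulPos m ψ) :=
  (ψ.2 m).2.choose_spec

/-- The quantity `‖∇ψ‖² + ‖x ψ‖²` for `ψ ∈ Q₀`. -/
def oscEnergy {M N : ℕ} (ψ : formDomain M N) : ℝ :=
  ∑ m, (‖partialD m ψ‖ ^ 2 + ‖mulPos m ψ‖ ^ 2)

/-! ### Quadratic forms on the form domain -/

/-- The quadratic form `⟨ψ, σ_z^n ψ⟩`. -/
def magForm {M N : ℕ} (n : Fin N) (ψ : formDomain M N) : ℂ :=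
  ⟪(ψ : Hil M N), sigmaZ M n ψ⟫_ℂ

/-- The quadratic form `⟨ψ, x_m ψ⟩`. -/
def dispForm {M N : ℕ} (m : Fin M) (ψ : formDomain M N) : ℂ :=
  ⟪(ψ : Hil M N), mulPos m ψ⟫_ℂ

/-- The quadratic form `⟨ψ, H₀ ψ⟩` of the Hamiltonian
`H₀ = ∑ₘ (-∂ₘ² + xₘ²) + ∑ₘ ∑ₙ xₘ Λₘₙ σ_z^n - ∑ₙ tₙ σ_x^n`. -/
def hamForm {M N : ℕ} (Λ : Matrix (Fin M) (Fin N) ℝ) (t : Fin N → ℝ) (ψ : formDomain M N) : ℂ :=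
  ∑ m, (⟪partialD m ψ, partialD m ψ⟫_ℂ + ⟪mulPos m ψ, mulPos m ψ⟫_ℂ)
    + ∑ m, ∑ n, (Λ m n : ℂ) * ⟪(ψ : Hil M N), sigmaZ M n (mulPos m ψ)⟫_ℂ
    - ∑ n, (t n : ℂ) * ⟪(ψ : Hil M N), sigmaX M n ψ⟫_ℂ

/-! ### Density matrices of finite energy -/

/-- `Γ = ∑_j c_j |ψ_j⟩⟨ψ_j|` with `c_j ≥ 0`, `∑_j c_j = 1`, orthonormal `ψ_j ∈ Q₀` and
`∑_j c_j (‖∇ψ_j‖² + ‖x ψ_j‖²) < ∞`. Vectors of weight `c_j = 0` do not contribute and are left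
unconstrained, so that finite sums are included. -/
structure IsSpectral {M N : ℕ} (Γ : Hil M N →L[ℂ] Hil M N) (c : ℕ → ℝ)
    (ψ : ℕ → formDomain M N) : Prop where
  nonneg : ∀ j, 0 ≤ c j
  sum_one : HasSum c 1
  orthonormal : Orthonormal ℂ fun j : {j // c j ≠ 0} => (ψ j : Hil M N)
  hasSum : HasSum
    (fun j => (c j : ℂ) • InnerProductSpace.rankOne ℂ (ψ j : Hil M N) (ψ j : Hil M N)) Γ
  finite_energy : Summable fun j => c j * oscEnergy (ψ j)

/-- The set `D(Q₀)` of density matrices of finite energy. -/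
def densityMatrices (M N : ℕ) : Set (Hil M N →L[ℂ] Hil M N) :=
  {Γ | ∃ c ψ, IsSpectral Γ c ψ}

open Classical in
/-- The trace `Tr(A Γ) = ∑_j c_j ⟨ψ_j, A ψ_j⟩` of a quadratic form `q ψ = ⟨ψ, A ψ⟩` against
`Γ = ∑_j c_j |ψ_j⟩⟨ψ_j| ∈ D(Q₀)`. By the lemmas below, for the forms in question the series
converges absolutely and its value does not depend on the decomposition of `Γ`. -/
def formTrace {M N : ℕ} (q : formDomain M N → ℂ) (Γ : Hil M N →L[ℂ] Hil M N) : ℂ :=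
  if h : ∃ p : (ℕ → ℝ) × (ℕ → formDomain M N), IsSpectral Γ p.1 p.2 then
    ∑' j, (h.choose.1 j : ℂ) * q (h.choose.2 j)
  else 0

/-- The magnetization `σ_Γ = (Tr σ_z^1 Γ, …, Tr σ_z^N Γ)`. -/
def magnetization {M N : ℕ} (Γ : Hil M N →L[ℂ] Hil M N) : Fin N → ℝ :=
  fun n => (formTrace (magForm n) Γ).re

/-- The displacement `ξ_Γ = ∑_j c_j ∫ x |ψ_j(x)|² dx`, that is, `ξ_Γ = ∫ x ρ(x) dx` with the
spin-summed diagonal `ρ(x) = Tr_{ℂ^{2^N}} Γ(x, x) = ∑_j c_j |ψ_j(x)|²` of the kernel of `Γ`. -/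
def displacement {M N : ℕ} (Γ : Hil M N →L[ℂ] Hil M N) : Fin M → ℝ :=
  fun m => (formTrace (dispForm m) Γ).re

/-- The internal energy `Tr(H₀ Γ)`. -/
def energy {M N : ℕ} (Λ : Matrix (Fin M) (Fin N) ℝ) (t : Fin N → ℝ)
    (Γ : Hil M N →L[ℂ] Hil M N) : ℝ :=
  (formTrace (hamForm Λ t) Γ).re

/-- The Lieb functional
`F_L(σ, ξ) = inf {Tr(H₀ Γ) : Γ ∈ D(Q₀), σ_Γ = σ, ξ_Γ = ξ}`, as an extended real number. -/
def liebFunctional {M N : ℕ} (Λ : Matrix (Fin M) (Fin N) ℝ) (t : Fin N → ℝ)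
    (σ : Fin N → ℝ) (ξ : Fin M → ℝ) : EReal :=
  sInf {e : EReal | ∃ Γ ∈ densityMatrices M N,
    magnetization Γ = σ ∧ displacement Γ = ξ ∧ e = (energy Λ t Γ : EReal)}

/-! ### The trace does not depend on the decomposition -/

section Independence

variable {H : Type*} [NormedAddCommGroup H] [InnerProductSpace ℂ H]

lemma isSymmetric_of_hasSum {Γ : H →L[ℂ] H} {c : ℕ → ℝ} {ψ : ℕ → H}
    (hΓ : HasSum (fun j => (c j : ℂ) • InnerProductSpace.rankOne ℂ (ψ j) (ψ j)) Γ) (x y : H) :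
    ⟪Γ x, y⟫_ℂ = ⟪x, Γ y⟫_ℂ := by
  have h1 : ∀ z, HasSum (fun j => (c j : ℂ) • ⟪ψ j, z⟫_ℂ • ψ j) (Γ z) := fun z => by
    simpa using hΓ.mapL (ContinuousLinearMap.apply ℂ H z)
  have h2 := (h1 y).mapL (innerSL ℂ x)
  have h3 := ((h1 x).mapL (innerSL ℂ y)).star
  simp only [innerSL_apply_apply, inner_smul_right] at h2 h3
  have h4 : star ⟪y, Γ x⟫_ℂ = ⟪Γ x, y⟫_ℂ := inner_conj_symm _ _
  rw [h4] at h3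
  refine h3.unique ?_
  convert h2 using 2 with j
  simp only [star_mul', RCLike.star_def, inner_conj_symm, Complex.conj_ofReal]
  ring

lemma eigenvector_of_hasSum {Γ : H →L[ℂ] H} {c : ℕ → ℝ} {ψ : ℕ → H}
    (hψ : Orthonormal ℂ fun j : {j // c j ≠ 0} => ψ j)
    (hΓ : HasSum (fun j => (c j : ℂ) • InnerProductSpace.rankOne ℂ (ψ j) (ψ j)) Γ)
    {j : ℕ} (hj : c j ≠ 0) : Γ (ψ j) = (c j : ℂ) • ψ j := by
  have h1 : HasSum (fun i => (c i : ℂ) • ⟪ψ i, ψ j⟫_ℂ • ψ i) (Γ (ψ j)) := by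
    simpa using hΓ.mapL (ContinuousLinearMap.apply ℂ H (ψ j))
  refine h1.unique ?_
  have h2 := hasSum_single (f := fun i => (c i : ℂ) • ⟪ψ i, ψ j⟫_ℂ • ψ i) j (fun i hij => by
    by_cases hi : c i = 0
    · simp [hi]
    · have := hψ.2 (i := ⟨i, hi⟩) (j := ⟨j, hj⟩) (by simpa using hij)
      simp only at this
      simp [this])
  have h3 : ⟪ψ j, ψ j⟫_ℂ = 1 := by
    have := hψ.1 ⟨j, hj⟩
    simp only at this
    rw [inner_self_eq_norm_sq_to_K, this]; simp
  simp only [h3, one_smul] at h2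
  exact h2

lemma expand_of_hasSum {Γ : H →L[ℂ] H} {c d : ℕ → ℝ} {ψ φ : ℕ → H}
    (hψ : Orthonormal ℂ fun j : {j // c j ≠ 0} => ψ j)
    (hφ : Orthonormal ℂ fun j : {j // d j ≠ 0} => φ j)
    (hΓ : HasSum (fun j => (c j : ℂ) • InnerProductSpace.rankOne ℂ (ψ j) (ψ j)) Γ)
    (hΓ' : HasSum (fun j => (d j : ℂ) • InnerProductSpace.rankOne ℂ (φ j) (φ j)) Γ)
    {r : ℝ} (hr : r ≠ 0) (T : Finset ℕ) (hT : ∀ k, k ∈ T ↔ d k = r) {j : ℕ} (hj : c j = r) :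
    ψ j = ∑ k ∈ T, ⟪φ k, ψ j⟫_ℂ • φ k := by
  have hcj : c j ≠ 0 := hj ▸ hr
  have hrC : (r : ℂ) ≠ 0 := by exact_mod_cast hr
  have h1 : HasSum (fun k => (d k : ℂ) • ⟪φ k, ψ j⟫_ℂ • φ k) (Γ (ψ j)) := by
    simpa using hΓ'.mapL (ContinuousLinearMap.apply ℂ H (ψ j))
  have h2 : HasSum (fun k => (d k : ℂ) • ⟪φ k, ψ j⟫_ℂ • φ k)
      (∑ k ∈ T, (d k : ℂ) • ⟪φ k, ψ j⟫_ℂ • φ k) :=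
    hasSum_sum_of_ne_finset_zero (fun k hk => by
      by_cases hd : d k = 0
      · simp [hd]
      · have e1 := isSymmetric_of_hasSum hΓ (φ k) (ψ j)
        rw [eigenvector_of_hasSum hφ hΓ' hd, eigenvector_of_hasSum hψ hΓ hcj, inner_smul_left,
          inner_smul_right, Complex.conj_ofReal, hj] at e1
        have e2 : (d k : ℂ) - r ≠ 0 := by
          rw [hT] at hk
          exact sub_ne_zero.mpr (by exact_mod_cast hk)
        have e3 : ((d k : ℂ) - r) * ⟪φ k, ψ j⟫_ℂ = 0 := by rw [sub_mul, e1, sub_self]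
        rw [(mul_eq_zero.mp e3).resolve_left e2]; simp)
  have h3 := h1.unique h2
  rw [eigenvector_of_hasSum hψ hΓ hcj, hj] at h3
  have h4 : ∑ k ∈ T, (d k : ℂ) • ⟪φ k, ψ j⟫_ℂ • φ k = (r : ℂ) • ∑ k ∈ T, ⟪φ k, ψ j⟫_ℂ • φ k := by
    rw [Finset.smul_sum]
    refine Finset.sum_congr rfl fun k hk => ?_
    rw [(hT k).mp hk]
  rw [h4] at h3
  exact smul_right_injective H hrC h3

lemma sum_fiber_eq {Q : Submodule ℂ H} (B : Q →ₗ⋆[ℂ] Q →ₗ[ℂ] ℂ)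
    {Γ : H →L[ℂ] H} {c d : ℕ → ℝ} {ψ φ : ℕ → Q}
    (hψ : Orthonormal ℂ fun j : {j // c j ≠ 0} => (ψ j : H))
    (hφ : Orthonormal ℂ fun j : {j // d j ≠ 0} => (φ j : H))
    (hΓ : HasSum (fun j => (c j : ℂ) • InnerProductSpace.rankOne ℂ (ψ j : H) (ψ j : H)) Γ)
    (hΓ' : HasSum (fun j => (d j : ℂ) • InnerProductSpace.rankOne ℂ (φ j : H) (φ j : H)) Γ)
    {r : ℝ} (hr : r ≠ 0) (S T : Finset ℕ) (hS : ∀ k, k ∈ S ↔ c k = r)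
    (hT : ∀ k, k ∈ T ↔ d k = r) :
    ∑ j ∈ S, B (ψ j) (ψ j) = ∑ k ∈ T, B (φ k) (φ k) := by
  have e1 : ∀ j ∈ S, ψ j = ∑ k ∈ T, ⟪(φ k : H), (ψ j : H)⟫_ℂ • φ k := fun j hj => by
    apply Subtype.ext
    have := expand_of_hasSum hψ hφ hΓ hΓ' hr T hT ((hS j).mp hj)
    simpa using this
  have e2 : ∀ k ∈ T, φ k = ∑ j ∈ S, ⟪(ψ j : H), (φ k : H)⟫_ℂ • ψ j := fun k hk => by
    apply Subtype.ext
    have := expand_of_hasSum hφ hψ hΓ' hΓ hr S hS ((hT k).mp hk)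
    simpa using this
  calc ∑ j ∈ S, B (ψ j) (ψ j)
      = ∑ j ∈ S, ∑ k ∈ T, ⟪(φ k : H), (ψ j : H)⟫_ℂ * B (ψ j) (φ k) := by
        refine Finset.sum_congr rfl fun j hj => ?_
        conv_lhs => rw [show B (ψ j) (ψ j) = B (ψ j) (∑ k ∈ T, ⟪(φ k : H), (ψ j : H)⟫_ℂ • φ k) from
          congrArg (B (ψ j)) (e1 j hj)]
        simp
    _ = ∑ k ∈ T, ∑ j ∈ S, ⟪(φ k : H), (ψ j : H)⟫_ℂ * B (ψ j) (φ k) := Finset.sum_comm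
    _ = ∑ k ∈ T, B (φ k) (φ k) := by
        refine Finset.sum_congr rfl fun k hk => ?_
        conv_rhs => rw [show B (φ k) (φ k) = B (∑ j ∈ S, ⟪(ψ j : H), (φ k : H)⟫_ℂ • ψ j) (φ k) from
          congrArg (fun z => B z (φ k)) (e2 k hk)]
        simp [LinearMap.sum_apply]

lemma finite_fiber {c : ℕ → ℝ} (hc : Summable c) {r : ℝ} (hr : r ≠ 0) : {j | c j = r}.Finite := by
  have h := hc.tendsto_cofinite_zero.eventually_ne hr.symm
  simpa [Filter.eventually_cofinite] using h

open Classical in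
lemma tsum_by_fibers {e : ℕ → ℝ} (he : Summable e) (g : ℕ → ℂ)
    (h : Summable fun j => (e j : ℂ) * g j) :
    ∑' j, (e j : ℂ) * g j = ∑' r : ℝ, if hr : r = 0 then 0 else
      (r : ℂ) * ∑ j ∈ (finite_fiber he hr).toFinset, g j := by
  have h0 := Summable.tsum_sigma ((Equiv.sigmaFiberEquiv e).summable_iff.mpr h)
  simp only [Function.comp_def] at h0
  rw [← (Equiv.sigmaFiberEquiv e).tsum_eq, h0]
  refine tsum_congr fun r => ?_
  have h1 : ∀ j : {j // e j = r},
      (e (Equiv.sigmaFiberEquiv e ⟨r, j⟩) : ℂ) * g (Equiv.sigmaFiberEquiv e ⟨r, j⟩)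
        = (r : ℂ) * g j := fun j => by
    rw [Equiv.sigmaFiberEquiv_apply, j.2]
  rw [tsum_congr h1]
  by_cases hr : r = 0
  · simp [hr]
  · rw [dif_neg hr, tsum_mul_left]
    congr 1
    have h2 : {j | e j = r} = ((finite_fiber he hr).toFinset : Set ℕ) := by simp
    have h3 := Finset.tsum_subtype' (finite_fiber he hr).toFinset g
    rw [← h2] at h3
    exact h3

lemma tsum_eq_of_decompositions {Q : Submodule ℂ H} (B : Q →ₗ⋆[ℂ] Q →ₗ[ℂ] ℂ)
    {Γ : H →L[ℂ] H} {c d : ℕ → ℝ} {ψ φ : ℕ → Q} (hc : Summable c) (hd : Summable d)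
    (hψ : Orthonormal ℂ fun j : {j // c j ≠ 0} => (ψ j : H))
    (hφ : Orthonormal ℂ fun j : {j // d j ≠ 0} => (φ j : H))
    (hΓ : HasSum (fun j => (c j : ℂ) • InnerProductSpace.rankOne ℂ (ψ j : H) (ψ j : H)) Γ)
    (hΓ' : HasSum (fun j => (d j : ℂ) • InnerProductSpace.rankOne ℂ (φ j : H) (φ j : H)) Γ)
    (hB : Summable fun j => (c j : ℂ) * B (ψ j) (ψ j))
    (hB' : Summable fun j => (d j : ℂ) * B (φ j) (φ j)) :
    ∑' j, (c j : ℂ) * B (ψ j) (ψ j) = ∑' j, (d j : ℂ) * B (φ j) (φ j) := by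
  rw [tsum_by_fibers hc _ hB, tsum_by_fibers hd _ hB']
  refine tsum_congr fun r => ?_
  by_cases hr : r = 0
  · simp [hr]
  · rw [dif_neg hr, dif_neg hr,
      sum_fiber_eq B hψ hφ hΓ hΓ' hr (finite_fiber hc hr).toFinset
        (finite_fiber hd hr).toFinset (by simp) (by simp)]

end Independence

/-- A quadratic form is admissible if it comes from a sesquilinear form on `Q₀` and is bounded by
the form norm; its trace against a density matrix is then well defined. -/
def Admissible {M N : ℕ} (q : formDomain M N → ℂ) : Prop :=
  (∃ B : formDomain M N →ₗ⋆[ℂ] formDomain M N →ₗ[ℂ] ℂ, ∀ ψ, q ψ = B ψ ψ) ∧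
    ∃ K : ℝ, ∀ ψ, ‖q ψ‖ ≤ K * (‖(ψ : Hil M N)‖ ^ 2 + oscEnergy ψ)

lemma oscEnergy_nonneg {M N : ℕ} (ψ : formDomain M N) : 0 ≤ oscEnergy ψ :=
  Finset.sum_nonneg fun _ _ => by positivity

lemma IsSpectral.summable {M N : ℕ} {q : formDomain M N → ℂ} (hq : Admissible q)
    {Γ : Hil M N →L[ℂ] Hil M N} {c : ℕ → ℝ} {ψ : ℕ → formDomain M N} (h : IsSpectral Γ c ψ) :
    Summable fun j => (c j : ℂ) * q (ψ j) := by
  obtain ⟨-, K, hK⟩ := hq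
  refine Summable.of_norm_bounded (g := fun j => K * (c j + c j * oscEnergy (ψ j)))
    ((h.sum_one.summable.add h.finite_energy).mul_left K) fun j => ?_
  by_cases hj : c j = 0
  · simp [hj]
  · have h1 : ‖(ψ j : Hil M N)‖ = 1 := h.orthonormal.1 ⟨j, hj⟩
    have h2 := hK (ψ j)
    rw [h1] at h2
    rw [norm_mul, Complex.norm_real, Real.norm_of_nonneg (h.nonneg j)]
    calc c j * ‖q (ψ j)‖ ≤ c j * (K * (1 ^ 2 + oscEnergy (ψ j))) :=
          mul_le_mul_of_nonneg_left h2 (h.nonneg j)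
      _ = _ := by ring

/-- The trace may be computed from every decomposition of `Γ`. -/
theorem IsSpectral.formTrace_eq {M N : ℕ} {q : formDomain M N → ℂ} (hq : Admissible q)
    {Γ : Hil M N →L[ℂ] Hil M N} {c : ℕ → ℝ} {ψ : ℕ → formDomain M N} (h : IsSpectral Γ c ψ) :
    formTrace q Γ = ∑' j, (c j : ℂ) * q (ψ j) := by
  have hex : ∃ p : (ℕ → ℝ) × (ℕ → formDomain M N), IsSpectral Γ p.1 p.2 := ⟨(c, ψ), h⟩
  have h' := hex.choose_spec
  rw [formTrace, dif_pos hex]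
  have s := h.summable hq
  have s' := h'.summable hq
  obtain ⟨⟨B, hB⟩, -⟩ := hq
  simp only [hB] at s s' ⊢
  exact tsum_eq_of_decompositions B h'.sum_one.summable h.sum_one.summable h'.orthonormal
    h.orthonormal h'.hasSum h.hasSum s' s

/-- The sesquilinear form `⟨S ψ, T χ⟩`. -/
def innerForm {M N : ℕ} (S T : formDomain M N →ₗ[ℂ] Hil M N) :
    formDomain M N →ₗ⋆[ℂ] formDomain M N →ₗ[ℂ] ℂ :=
  ((innerₛₗ ℂ).comp S).compl₂ T

lemma admissible_inner {M N : ℕ} (S T : formDomain M N →ₗ[ℂ] Hil M N) {a b : ℝ}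
    (hS : ∀ ψ, ‖S ψ‖ ^ 2 ≤ a * (‖(ψ : Hil M N)‖ ^ 2 + oscEnergy ψ))
    (hT : ∀ ψ, ‖T ψ‖ ^ 2 ≤ b * (‖(ψ : Hil M N)‖ ^ 2 + oscEnergy ψ)) :
    Admissible fun ψ => ⟪S ψ, T ψ⟫_ℂ := by
  refine ⟨⟨innerForm S T, fun ψ => rfl⟩, a + b, fun ψ => ?_⟩
  have h1 := norm_inner_le_norm (𝕜 := ℂ) (S ψ) (T ψ)
  have h2 := hS ψ
  have h3 := hT ψ
  nlinarith [sq_nonneg (‖S ψ‖ - ‖T ψ‖), sq_nonneg ‖S ψ‖, sq_nonneg ‖T ψ‖]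

lemma Admissible.add {M N : ℕ} {q q' : formDomain M N → ℂ} (h : Admissible q)
    (h' : Admissible q') : Admissible fun ψ => q ψ + q' ψ := by
  obtain ⟨⟨B, hB⟩, K, hK⟩ := h
  obtain ⟨⟨B', hB'⟩, K', hK'⟩ := h'
  refine ⟨⟨B + B', fun ψ => by simp [hB, hB']⟩, K + K', fun ψ => ?_⟩
  have := norm_add_le (q ψ) (q' ψ)
  linarith [hK ψ, hK' ψ, add_mul K K' (‖(ψ : Hil M N)‖ ^ 2 + oscEnergy ψ)]

lemma Admissible.const_mul {M N : ℕ} {q : formDomain M N → ℂ} (a : ℂ) (h : Admissible q) :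
    Admissible fun ψ => a * q ψ := by
  obtain ⟨⟨B, hB⟩, K, hK⟩ := h
  refine ⟨⟨a • B, fun ψ => by simp [hB]⟩, ‖a‖ * K, fun ψ => ?_⟩
  rw [norm_mul, mul_assoc]
  exact mul_le_mul_of_nonneg_left (hK ψ) (norm_nonneg a)

lemma Admissible.zero {M N : ℕ} : Admissible fun _ : formDomain M N => (0 : ℂ) :=
  ⟨⟨0, fun _ => rfl⟩, 0, fun ψ => by simp⟩

lemma Admissible.sum {M N : ℕ} {ι : Type*} (s : Finset ι) {q : ι → formDomain M N → ℂ}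
    (h : ∀ i, Admissible (q i)) : Admissible fun ψ => ∑ i ∈ s, q i ψ := by
  classical
  induction s using Finset.induction_on with
  | empty => simpa using Admissible.zero
  | insert i s hi ih => simpa [Finset.sum_insert hi] using (h i).add ih

lemma bound_subtype {M N : ℕ} (ψ : formDomain M N) :
    ‖(formDomain M N).subtype ψ‖ ^ 2 ≤ 1 * (‖(ψ : Hil M N)‖ ^ 2 + oscEnergy ψ) := by
  have := oscEnergy_nonneg ψ
  simpa using this

lemma bound_partialD {M N : ℕ} (m : Fin M) (ψ : formDomain M N) :
    ‖partialD m ψ‖ ^ 2 ≤ 1 * (‖(ψ : Hil M N)‖ ^ 2 + oscEnergy ψ) := by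
  have h := Finset.single_le_sum (f := fun m => ‖partialD m ψ‖ ^ 2 + ‖mulPos m ψ‖ ^ 2)
    (fun _ _ => by positivity) (Finset.mem_univ m)
  unfold oscEnergy
  nlinarith [sq_nonneg ‖mulPos m ψ‖, sq_nonneg ‖(ψ : Hil M N)‖]

lemma bound_mulPos {M N : ℕ} (m : Fin M) (ψ : formDomain M N) :
    ‖mulPos m ψ‖ ^ 2 ≤ 1 * (‖(ψ : Hil M N)‖ ^ 2 + oscEnergy ψ) := by
  have h := Finset.single_le_sum (f := fun m => ‖partialD m ψ‖ ^ 2 + ‖mulPos m ψ‖ ^ 2)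
    (fun _ _ => by positivity) (Finset.mem_univ m)
  unfold oscEnergy
  nlinarith [sq_nonneg ‖partialD m ψ‖, sq_nonneg ‖(ψ : Hil M N)‖]

lemma bound_comp {M N : ℕ} (A : Hil M N →L[ℂ] Hil M N) (T : formDomain M N →ₗ[ℂ] Hil M N)
    (hT : ∀ ψ, ‖T ψ‖ ^ 2 ≤ 1 * (‖(ψ : Hil M N)‖ ^ 2 + oscEnergy ψ)) (ψ : formDomain M N) :
    ‖((A : Hil M N →ₗ[ℂ] Hil M N).comp T) ψ‖ ^ 2
      ≤ ‖A‖ ^ 2 * (‖(ψ : Hil M N)‖ ^ 2 + oscEnergy ψ) := by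
  have h1 : ‖A (T ψ)‖ ≤ ‖A‖ * ‖T ψ‖ := A.le_opNorm _
  have h2 : ‖A (T ψ)‖ ^ 2 ≤ (‖A‖ * ‖T ψ‖) ^ 2 := by gcongr
  have h3 := hT ψ
  rw [one_mul] at h3
  calc ‖A (T ψ)‖ ^ 2 ≤ ‖A‖ ^ 2 * ‖T ψ‖ ^ 2 := by rw [← mul_pow]; exact h2
    _ ≤ _ := by gcongr

lemma admissible_inner_op {M N : ℕ} (A : Hil M N →L[ℂ] Hil M N)
    (T : formDomain M N →ₗ[ℂ] Hil M N)
    (hT : ∀ ψ, ‖T ψ‖ ^ 2 ≤ 1 * (‖(ψ : Hil M N)‖ ^ 2 + oscEnergy ψ)) :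
    Admissible fun ψ : formDomain M N => ⟪(ψ : Hil M N), A (T ψ)⟫_ℂ :=
  admissible_inner (formDomain M N).subtype ((A : Hil M N →ₗ[ℂ] Hil M N).comp T) bound_subtype
    (bound_comp A T hT)

lemma admissible_magForm {M N : ℕ} (n : Fin N) : Admissible (magForm (M := M) n) :=
  admissible_inner_op (sigmaZ M n) (formDomain M N).subtype bound_subtype

lemma admissible_dispForm {M N : ℕ} (m : Fin M) : Admissible (dispForm (N := N) m) :=
  admissible_inner (formDomain M N).subtype (mulPos m) bound_subtype (bound_mulPos m)

lemma admissible_hamForm {M N : ℕ} (Λ : Matrix (Fin M) (Fin N) ℝ) (t : Fin N → ℝ) :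
    Admissible (hamForm Λ t) := by
  have h1 : Admissible fun ψ : formDomain M N =>
      ∑ m, (⟪partialD m ψ, partialD m ψ⟫_ℂ + ⟪mulPos m ψ, mulPos m ψ⟫_ℂ) :=
    Admissible.sum _ fun m => (admissible_inner (partialD m) (partialD m) (bound_partialD m)
      (bound_partialD m)).add
      (admissible_inner (mulPos m) (mulPos m) (bound_mulPos m) (bound_mulPos m))
  have h2 : Admissible fun ψ : formDomain M N =>
      ∑ m, ∑ n, (Λ m n : ℂ) * ⟪(ψ : Hil M N), sigmaZ M n (mulPos m ψ)⟫_ℂ :=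
    Admissible.sum _ fun m => Admissible.sum _ fun n => Admissible.const_mul _
      (admissible_inner_op (sigmaZ M n) (mulPos m) (bound_mulPos m))
  have h3 : Admissible fun ψ : formDomain M N =>
      ∑ n, (t n : ℂ) * ⟪(ψ : Hil M N), sigmaX M n ψ⟫_ℂ :=
    Admissible.sum _ fun n => Admissible.const_mul _
      (admissible_inner_op (sigmaX M n) (formDomain M N).subtype bound_subtype)
  have h := (h1.add h2).add (h3.const_mul (-1))
  have e : hamForm Λ t = fun ψ => (∑ m, (⟪partialD m ψ, partialD m ψ⟫_ℂ
      + ⟪mulPos m ψ, mulPos m ψ⟫_ℂ)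
      + ∑ m, ∑ n, (Λ m n : ℂ) * ⟪(ψ : Hil M N), sigmaZ M n (mulPos m ψ)⟫_ℂ)
      + (-1) * ∑ n, (t n : ℂ) * ⟪(ψ : Hil M N), sigmaX M n ψ⟫_ℂ := by
    funext ψ
    simp only [hamForm]
    ring
  rw [e]
  exact h

end Dicke

end

/-! The proof is the direct method. Cauchy–Schwarz and Young bound the coupling and tunnelling terms
by half the oscillator energy plus a multiple of the squared norm (`exists_oscEnergy_le`). Hence the
energy is bounded below and has bounded oscillator energy along a minimizing sequence. The
constraint set is nonempty: a bump function centred at ξ, tensored with a product spin vector, meets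
both constraints (`exists_trial_state`).

With `φ_j = √c_j ψ_j`, a density matrix becomes a unit vector of ℓ²(ℕ, L²) with mutually orthogonal
components, and traces become inner products in that space. Along an ultrafilter the sequences `φ`,
`∂_m φ` and `x_m φ` have weak limits, and these are compatible because being a derivative or a
coordinate multiple is tested against Schwartz functions. What has to be excluded is loss of mass,
either inside one component or towards `j → ∞`.

One estimate excludes both: `exists_finset_norm_sq_le` bounds the squared norm by ε times the form
norm plus finitely many squared inner products. It comes from cutting off in position and in
momentum, since χ𝓕χ is Hilbert–Schmidt. For a fixed component it turns weak into strong convergence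
(`tendsto_of_weak_limit`). For the tail, the weights are listed in decreasing order, so that `‖φ_j‖²
≤ 1/(j+1)`; Bessel's inequality then makes the finitely many inner products of order `1/J` beyond
index `J`, uniformly in the system (`exists_one_sub_le_sum`).

So `φ` converges strongly in ℓ²(ℕ, L²). Strong against weak convergence gives the limits of
magnetization, displacement and coupling, while the oscillator energy is weakly lower semicontinuous
(`exists_limit_orthSystem`). The limit therefore satisfies the constraints and has minimal energy.
-/

noncomputable section

namespace Dicke

/-! ### Square summable sequences -/

/-- The element of `ℓ²(ℕ, H)` given by a square summable sequence. -/
def ofSq {H : Type*} [NormedAddCommGroup H] (f : ℕ → H) (hf : Summable fun j => ‖f j‖ ^ 2) : lp (fun _ : ℕ => H) 2 :=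
  ⟨f, memℓp_gen (by simpa using hf)⟩

lemma norm_lp_sq {H : Type*} [NormedAddCommGroup H] (f : lp (fun _ : ℕ => H) 2) : ‖f‖ ^ 2 = ∑' j, ‖f j‖ ^ 2 := by
  have := lp.norm_rpow_eq_tsum (p := 2) (by norm_num) f
  simpa using this

lemma summable_lp_sq {H : Type*} [NormedAddCommGroup H] (f : lp (fun _ : ℕ => H) 2) : Summable fun j => ‖f j‖ ^ 2 := by
  have := (lp.memℓp f).summable (by norm_num)
  simpa using this

/-! ### Weak limits and Hilbert–Schmidt operators -/

section HilbertSpace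

open Filter Topology

variable {H H' : Type*} [NormedAddCommGroup H] [InnerProductSpace ℂ H]
  [NormedAddCommGroup H'] [InnerProductSpace ℂ H']

/-- Banach–Alaoglu, carried to `H` by the Riesz isomorphism. With an ultrafilter the whole family
converges, so neither separability nor a diagonal extraction is needed. -/
theorem exists_weak_limit [CompleteSpace H] {ι : Type*} (U : Ultrafilter ι) {u : ι → H} {C : ℝ}
    (hu : ∀ k, ‖u k‖ ≤ C) : ∃ v : H, ∀ w, Tendsto (fun k => ⟪w, u k⟫_ℂ) U (𝓝 ⟪w, v⟫_ℂ) := by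
  have hK := WeakDual.isCompact_closedBall (0 : StrongDual ℂ H) C
  set g : ι → WeakDual ℂ H := fun k => StrongDual.toWeakDual (InnerProductSpace.toDual ℂ H (u k))
    with hg
  obtain ⟨x, -, hx⟩ := hK.ultrafilter_le_nhds (U.map g) (by
    rw [le_principal_iff, Ultrafilter.coe_map]
    refine mem_map.mpr (Eventually.of_forall fun k => ?_)
    have : ‖InnerProductSpace.toDual ℂ H (u k)‖ ≤ C := by simpa using hu k
    simpa [hg] using this)
  refine ⟨(InnerProductSpace.toDual ℂ H).symm (WeakDual.toStrongDual x), fun w => ?_⟩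
  have h1 : Tendsto (fun k => g k w) U (𝓝 (x w)) :=
    ((WeakDual.eval_continuous w).tendsto x).comp hx
  -- The Riesz map puts `u k` into the first slot; conjugating moves it to the second.
  have h2 : Tendsto (fun k => star (g k w)) U (𝓝 (star (x w))) :=
    (continuous_star.tendsto _).comp h1
  have h3 : ∀ k, star (g k w) = ⟪w, u k⟫_ℂ := fun k => inner_conj_symm w (u k)
  have h4 : star (x w) = ⟪w, (InnerProductSpace.toDual ℂ H).symm (WeakDual.toStrongDual x)⟫_ℂ := by
    rw [← inner_conj_symm, InnerProductSpace.toDual_symm_apply]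
    rfl
  simpa only [h3, h4] using h2

/-- Bessel's inequality without normalization, so that zero vectors are allowed. For `w = ∑ ⟪φ_j, v⟫
φ_j` the left side `S` equals `⟪w, v⟫`, while orthogonality gives `‖w‖² ≤ r S`; Cauchy–Schwarz then
closes the loop. -/
theorem sum_norm_inner_sq_le {φ : ℕ → H} (hφ : Pairwise fun i j => ⟪φ i, φ j⟫_ℂ = 0)
    (s : Finset ℕ) {r : ℝ} (hr0 : 0 ≤ r) (hr : ∀ j ∈ s, ‖φ j‖ ^ 2 ≤ r) (v : H) :
    ∑ j ∈ s, ‖⟪φ j, v⟫_ℂ‖ ^ 2 ≤ r * ‖v‖ ^ 2 := by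
  set S := ∑ j ∈ s, ‖⟪φ j, v⟫_ℂ‖ ^ 2 with hS
  have hS0 : 0 ≤ S := Finset.sum_nonneg fun _ _ => by positivity
  set w : H := ∑ j ∈ s, ⟪φ j, v⟫_ℂ • φ j with hw
  have h1 : ‖w‖ ^ 2 = ∑ j ∈ s, ‖⟪φ j, v⟫_ℂ‖ ^ 2 * ‖φ j‖ ^ 2 := by
    have e1 : ∀ j ∈ s, ⟪φ j, w⟫_ℂ = ⟪φ j, v⟫_ℂ * (‖φ j‖ ^ 2 : ℝ) := fun j hj => by
      rw [hw, inner_sum, Finset.sum_eq_single_of_mem j hj]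
      · rw [inner_smul_right, inner_self_eq_norm_sq_to_K]; push_cast; rfl
      · intro i _ hij
        rw [inner_smul_right, hφ hij.symm, mul_zero]
    have e2 : ((‖w‖ ^ 2 : ℝ) : ℂ) = ((∑ j ∈ s, ‖⟪φ j, v⟫_ℂ‖ ^ 2 * ‖φ j‖ ^ 2 : ℝ) : ℂ) := by
      have e3 : ((‖w‖ ^ 2 : ℝ) : ℂ) = ⟪w, w⟫_ℂ := by
        rw [inner_self_eq_norm_sq_to_K]; push_cast; rfl
      rw [e3]
      conv_lhs => rw [hw, sum_inner]
      push_cast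
      refine Finset.sum_congr rfl fun j hj => ?_
      rw [inner_smul_left, ← hw, e1 j hj, ← mul_assoc, RCLike.conj_mul]
      push_cast
      rfl
    exact_mod_cast e2
  have h2 : ⟪w, v⟫_ℂ = (S : ℂ) := by
    rw [hw, sum_inner, hS]
    push_cast
    refine Finset.sum_congr rfl fun j _ => ?_
    rw [inner_smul_left, RCLike.conj_mul]
    rfl
  have h3 : S ≤ ‖w‖ * ‖v‖ := by
    have := norm_inner_le_norm (𝕜 := ℂ) w v
    rwa [h2, Complex.norm_real, Real.norm_of_nonneg hS0] at this
  have h4 : ‖w‖ ^ 2 ≤ r * S := by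
    rw [h1, hS, Finset.mul_sum]
    refine Finset.sum_le_sum fun j hj => ?_
    rw [mul_comm]
    exact mul_le_mul_of_nonneg_right (hr j hj) (by positivity)
  have h5 : S * S ≤ r * ‖v‖ ^ 2 * S := by
    calc S * S ≤ (‖w‖ * ‖v‖) * (‖w‖ * ‖v‖) := mul_self_le_mul_self hS0 h3
      _ = ‖w‖ ^ 2 * ‖v‖ ^ 2 := by ring
      _ ≤ (r * S) * ‖v‖ ^ 2 := by gcongr
      _ = _ := by ring
  rcases hS0.eq_or_lt with h | h
  · rw [← h]; positivity
  · exact le_of_mul_le_mul_right h5 h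

/-- A quantitative form of compactness of Hilbert–Schmidt operators. Outside the span of the `b i`,
`i ∈ F`, Cauchy–Schwarz bounds `B` by the tail of `∑ ‖B (b i)‖²`, chosen below `ε / 2`; the factors
2 come from squaring the sum of the two pieces. -/
theorem exists_finset_norm_apply_le {ι : Type*} (b : HilbertBasis ι ℂ H) (B : H →L[ℂ] H')
    (hB : Summable fun i => ‖B (b i)‖ ^ 2) {ε : ℝ} (hε : 0 < ε) :
    ∃ F : Finset ι, ∀ v, ‖B v‖ ^ 2 ≤ ε * ‖v‖ ^ 2 + 2 * ‖B‖ ^ 2 * ∑ i ∈ F, ‖⟪b i, v⟫_ℂ‖ ^ 2 := by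
  classical
  obtain ⟨F, hF⟩ := summable_iff_vanishing_norm.mp hB (ε / 2) (by positivity)
  refine ⟨F, fun v => ?_⟩
  set p : Finset ι → H := fun T => ∑ i ∈ T, ⟪b i, v⟫_ℂ • b i with hp
  have hv : Tendsto p atTop (𝓝 v) := by
    have := b.hasSum_repr v
    simp only [b.repr_apply_apply] at this
    exact this
  have hbes : ∀ T : Finset ι, ∑ i ∈ T, ‖⟪b i, v⟫_ℂ‖ ^ 2 ≤ ‖v‖ ^ 2 := fun T =>
    b.orthonormal.sum_inner_products_le v
  have h1 : ∀ T, F ⊆ T → ‖B (p T - p F)‖ ^ 2 ≤ (ε / 2) * ‖v‖ ^ 2 := fun T hT => by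
    have e1 : p T - p F = ∑ i ∈ T \ F, ⟪b i, v⟫_ℂ • b i := by
      rw [hp]; simp only
      rw [← Finset.sum_sdiff hT, add_sub_cancel_right]
    have e2 : ‖B (p T - p F)‖ ≤ ∑ i ∈ T \ F, ‖⟪b i, v⟫_ℂ‖ * ‖B (b i)‖ := by
      rw [e1, map_sum]
      refine (norm_sum_le _ _).trans (Finset.sum_le_sum fun i _ => ?_)
      rw [map_smul, norm_smul]
    have e3 : (∑ i ∈ T \ F, ‖⟪b i, v⟫_ℂ‖ * ‖B (b i)‖) ^ 2 ≤ _ :=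
      Finset.sum_mul_sq_le_sq_mul_sq _ _ _
    have e4 := hF (T \ F) Finset.sdiff_disjoint
    rw [Real.norm_of_nonneg (Finset.sum_nonneg fun _ _ => by positivity)] at e4
    calc ‖B (p T - p F)‖ ^ 2 ≤ (∑ i ∈ T \ F, ‖⟪b i, v⟫_ℂ‖ * ‖B (b i)‖) ^ 2 := by gcongr
      _ ≤ _ := e3
      _ ≤ ‖v‖ ^ 2 * (ε / 2) := by
        gcongr
        exact hbes _
      _ = _ := by ring
  have h2 : ‖B (v - p F)‖ ^ 2 ≤ (ε / 2) * ‖v‖ ^ 2 := by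
    have : Tendsto (fun T => ‖B (p T - p F)‖ ^ 2) atTop (𝓝 (‖B (v - p F)‖ ^ 2)) :=
      ((B.continuous.tendsto _).comp (hv.sub_const _)).norm.pow 2
    exact le_of_tendsto this ((eventually_ge_atTop F).mono h1)
  have h3 : ‖p F‖ ^ 2 = ∑ i ∈ F, ‖⟪b i, v⟫_ℂ‖ ^ 2 := by
    have := b.orthonormal.inner_sum (fun i => ⟪b i, v⟫_ℂ) (fun i => ⟪b i, v⟫_ℂ) F
    rw [inner_self_eq_norm_sq_to_K] at this
    have h : ((‖p F‖ ^ 2 : ℝ) : ℂ) = ((∑ i ∈ F, ‖⟪b i, v⟫_ℂ‖ ^ 2 : ℝ) : ℂ) := by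
      push_cast
      refine this.trans (Finset.sum_congr rfl fun i _ => ?_)
      rw [RCLike.conj_mul]; rfl
    exact_mod_cast h
  have h4 : ‖B (p F)‖ ^ 2 ≤ ‖B‖ ^ 2 * ∑ i ∈ F, ‖⟪b i, v⟫_ℂ‖ ^ 2 := by
    rw [← h3, ← mul_pow]
    gcongr
    exact B.le_opNorm _
  have h5 : ‖B v‖ ≤ ‖B (v - p F)‖ + ‖B (p F)‖ := by
    rw [map_sub]; simpa using norm_add_le (B v - B (p F)) (B (p F))
  calc ‖B v‖ ^ 2 ≤ (‖B (v - p F)‖ + ‖B (p F)‖) ^ 2 := by gcongr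
    _ ≤ 2 * (‖B (v - p F)‖ ^ 2 + ‖B (p F)‖ ^ 2) := add_sq_le
    _ ≤ _ := by linarith

/-- Test against the sequence whose only nonzero entry is `w` at position `j`. -/
theorem weak_limit_apply [CompleteSpace H] {ι : Type*} {U : Ultrafilter ι}
    {b : ι → lp (fun _ : ℕ => H) 2} {v : lp (fun _ : ℕ => H) 2}
    (h : ∀ w, Tendsto (fun k => ⟪w, b k⟫_ℂ) U (𝓝 ⟪w, v⟫_ℂ)) (j : ℕ) (w : H) :
    Tendsto (fun k => ⟪w, b k j⟫_ℂ) U (𝓝 ⟪w, v j⟫_ℂ) := by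
  simpa only [lp.inner_single_left] using h (lp.single 2 j w)

theorem weak_limit_unique {ι : Type*} {U : Ultrafilter ι} {u : ι → H} {v v' : H}
    (h : ∀ w, Tendsto (fun k => ⟪w, u k⟫_ℂ) U (𝓝 ⟪w, v⟫_ℂ))
    (h' : ∀ w, Tendsto (fun k => ⟪w, u k⟫_ℂ) U (𝓝 ⟪w, v'⟫_ℂ)) : v = v' :=
  ext_inner_left ℂ fun w => tendsto_nhds_unique (h w) (h' w)

theorem tendsto_inner_strong_weak {ι : Type*} {U : Ultrafilter ι} {a b : ι → H} {a₀ b₀ : H}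
    {C : ℝ} (ha : Tendsto a U (𝓝 a₀)) (hC : ∀ k, ‖b k‖ ≤ C)
    (hb : ∀ w, Tendsto (fun k => ⟪w, b k⟫_ℂ) U (𝓝 ⟪w, b₀⟫_ℂ)) :
    Tendsto (fun k => ⟪a k, b k⟫_ℂ) U (𝓝 ⟪a₀, b₀⟫_ℂ) := by
  have h1 : Tendsto (fun k => ⟪a k - a₀, b k⟫_ℂ) U (𝓝 0) := by
    have h2 : Tendsto (fun k => ‖a k - a₀‖ * C) U (𝓝 0) := by
      simpa using (tendsto_iff_norm_sub_tendsto_zero.mp ha).mul_const C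
    refine squeeze_zero_norm (fun k => ?_) h2
    exact (norm_inner_le_norm _ _).trans (by gcongr; exact hC k)
  have := h1.add (hb a₀)
  simpa [inner_sub_left] using this

/-- A strongly convergent sequence paired with a bounded, componentwise weakly convergent one. -/
theorem tendsto_tsum_inner [CompleteSpace H] {ι : Type*} {U : Ultrafilter ι}
    {a : ι → lp (fun _ : ℕ => H) 2} {a₀ : lp (fun _ : ℕ => H) 2} (ha : Tendsto a U (𝓝 a₀))
    {b : ι → lp (fun _ : ℕ => H) 2} {C : ℝ} (hC : ∀ k, ‖b k‖ ≤ C) {b₀ : ℕ → H}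
    (hb : ∀ j w, Tendsto (fun k => ⟪w, b k j⟫_ℂ) U (𝓝 ⟪w, b₀ j⟫_ℂ)) :
    Tendsto (fun k => ∑' j, ⟪a k j, b k j⟫_ℂ) U (𝓝 (∑' j, ⟪a₀ j, b₀ j⟫_ℂ)) := by
  -- Square summability of `b₀` is not assumed: boundedness provides a weak limit in ℓ², and its
  -- components must be those of `b₀`.
  obtain ⟨v, hv⟩ := exists_weak_limit U hC
  have h1 : ∀ j, b₀ j = v j := fun j => weak_limit_unique (hb j) (weak_limit_apply hv j)
  simp only [h1, ← lp.inner_eq_tsum]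
  exact tendsto_inner_strong_weak ha hC hv

end HilbertSpace

/-! ### Density matrices as orthogonal systems -/

/-- The vectors `φ_j = √c_j ψ_j` of a density matrix `∑_j c_j |ψ_j⟩⟨ψ_j|`: orthogonal, of total
squared norm one and of finite total oscillator energy. -/
structure IsOrthSystem {M N : ℕ} (φ : ℕ → formDomain M N) : Prop where
  orthogonal : Pairwise fun i j => ⟪(φ i : Hil M N), (φ j : Hil M N)⟫_ℂ = 0
  sum_one : HasSum (fun j => ‖(φ j : Hil M N)‖ ^ 2) 1
  finite_energy : Summable fun j => oscEnergy (φ j)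

lemma Admissible.apply_smul {M N : ℕ} {q : formDomain M N → ℂ} (hq : Admissible q) (a : ℂ)
    (ψ : formDomain M N) : q (a • ψ) = (‖a‖ ^ 2 : ℝ) * q ψ := by
  obtain ⟨⟨B, hB⟩, -⟩ := hq
  rw [hB, hB]
  simp only [LinearMap.map_smulₛₗ, LinearMap.smul_apply, map_smul, smul_eq_mul]
  rw [← mul_assoc, RCLike.mul_conj]
  push_cast
  rfl

lemma oscEnergy_smul {M N : ℕ} (a : ℂ) (ψ : formDomain M N) :
    oscEnergy (a • ψ) = ‖a‖ ^ 2 * oscEnergy ψ := by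
  unfold oscEnergy
  rw [Finset.mul_sum]
  refine Finset.sum_congr rfl fun m _ => ?_
  rw [map_smul, map_smul, norm_smul, norm_smul]
  ring

lemma IsOrthSystem.summable {M N : ℕ} {φ : ℕ → formDomain M N} (h : IsOrthSystem φ)
    {q : formDomain M N → ℂ} (hq : Admissible q) : Summable fun j => q (φ j) := by
  obtain ⟨-, K, hK⟩ := hq
  exact Summable.of_norm_bounded ((h.sum_one.summable.add h.finite_energy).mul_left K)
    fun j => hK (φ j)

/-- Every orthogonal system comes from a density matrix. -/
theorem IsOrthSystem.exists_density {M N : ℕ} {φ : ℕ → formDomain M N} (h : IsOrthSystem φ) :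
    ∃ Γ ∈ densityMatrices M N, ∀ q : formDomain M N → ℂ, Admissible q →
      formTrace q Γ = ∑' j, q (φ j) := by
  set n : ℕ → ℝ := fun j => ‖(φ j : Hil M N)‖ with hn
  -- Since `0⁻¹ = 0`, a vanishing `φ j` gives `ψ j = 0` with weight 0, which `IsSpectral` leaves
  -- unconstrained.
  set ψ : ℕ → formDomain M N := fun j => ((n j : ℂ)⁻¹) • φ j with hψ
  have hφψ : ∀ j, φ j = (n j : ℂ) • ψ j := fun j => by
    by_cases h0 : n j = 0
    · have : φ j = 0 := by
        apply Subtype.ext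
        simpa [hn] using h0
      simp [hψ, this]
    · have : (n j : ℂ) ≠ 0 := by exact_mod_cast h0
      rw [hψ]
      simp only
      rw [smul_smul, mul_inv_cancel₀ this, one_smul]
  have hnn : ∀ j, ‖(n j : ℂ)‖ ^ 2 = n j ^ 2 := fun j => by
    rw [Complex.norm_real, Real.norm_eq_abs, sq_abs]
  have hψ1 : ∀ j, n j ≠ 0 → ‖(ψ j : Hil M N)‖ = 1 := fun j hj => by
    have h0 : 0 ≤ n j := norm_nonneg _
    rw [hψ]
    simp only [Submodule.coe_smul]
    rw [norm_smul, norm_inv, Complex.norm_real, Real.norm_of_nonneg h0]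
    exact inv_mul_cancel₀ hj
  have hsum : Summable fun j => ((n j ^ 2 : ℝ) : ℂ) •
      InnerProductSpace.rankOne ℂ (ψ j : Hil M N) (ψ j : Hil M N) := by
    refine Summable.of_norm_bounded h.sum_one.summable fun j => ?_
    rw [norm_smul, Complex.norm_real, Real.norm_of_nonneg (sq_nonneg _)]
    by_cases hj : n j = 0
    · simp [hj]
    · rw [InnerProductSpace.norm_rankOne, hψ1 j hj]
      simp [hn]
  have hspec : IsSpectral _ (fun j => n j ^ 2) ψ := {
    nonneg := fun j => sq_nonneg _
    sum_one := h.sum_one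
    orthonormal := by
      refine ⟨fun j => hψ1 _ fun h0 => j.2 (by simp [h0]), fun i j hij => ?_⟩
      simp only [hψ, Submodule.coe_smul, inner_smul_left, inner_smul_right]
      rw [h.orthogonal fun e => hij (Subtype.ext e)]
      simp
    hasSum := hsum.hasSum
    finite_energy := by
      refine h.finite_energy.congr fun j => ?_
      conv_lhs => rw [hφψ j]
      rw [oscEnergy_smul, hnn] }
  refine ⟨_, ⟨_, _, hspec⟩, fun q hq => ?_⟩
  rw [hspec.formTrace_eq hq]
  refine tsum_congr fun j => ?_
  conv_rhs => rw [hφψ j, hq.apply_smul, hnn]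

/-! ### Ordering the weights -/

/-- The rank of `j` when the positive weights are listed in decreasing order. -/
def weightRank (c : ℕ → ℝ) (j : ℕ) : ℕ := {i | c j < c i ∨ (c i = c j ∧ i < j)}.ncard

lemma finite_weight_ge {c : ℕ → ℝ} (hc : Summable c) {r : ℝ} (hr : 0 < r) :
    {i | r ≤ c i}.Finite := by
  have h := hc.tendsto_cofinite_zero.eventually_lt_const hr
  simpa [Filter.eventually_cofinite] using h

lemma finite_weightRank_set {c : ℕ → ℝ} (hc : Summable c) {j : ℕ} (hj : 0 < c j) :
    {i | c j < c i ∨ (c i = c j ∧ i < j)}.Finite :=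
  (finite_weight_ge hc hj).subset fun i hi => by
    rcases hi with hi | hi
    · exact hi.le
    · exact hi.1.ge

/-- Breaking ties by the index makes the ordering strict and transitive. The predecessors of `i` are
then predecessors of `j`, and `i` itself is an additional one; positivity of `c j` keeps the sets
finite. -/
lemma weightRank_lt {c : ℕ → ℝ} (hc : Summable c) {i j : ℕ} (hj : 0 < c j)
    (h : c j < c i ∨ (c i = c j ∧ i < j)) : weightRank c i < weightRank c j := by
  refine Set.ncard_lt_ncard (Set.ssubset_iff_exists.mpr ⟨fun k hk => ?_, i, h, ?_⟩)
    (finite_weightRank_set hc hj)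
  · simp only [Set.mem_ofPred_eq] at hk ⊢
    rcases h with h | ⟨h, h'⟩ <;> rcases hk with hk | ⟨hk, hk'⟩
    · exact Or.inl (h.trans hk)
    · exact Or.inl (h.trans_eq hk.symm)
    · exact Or.inl (h ▸ hk)
    · exact Or.inr ⟨hk.trans h, hk'.trans h'⟩
  · simp

lemma weightRank_injective {c : ℕ → ℝ} (hc : Summable c) :
    Function.Injective fun j : {j // 0 < c j} => weightRank c j := by
  intro i j hij
  by_contra hne
  have hne' : (i : ℕ) ≠ j := fun h => hne (Subtype.ext h)
  simp only at hij
  rcases lt_trichotomy (c i) (c j) with h | h | h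
  · exact (weightRank_lt hc i.2 (Or.inl h)).ne' hij
  · rcases hne'.lt_or_gt with h' | h'
    · exact (weightRank_lt hc j.2 (Or.inr ⟨h, h'⟩)).ne hij
    · exact (weightRank_lt hc i.2 (Or.inr ⟨h.symm, h'⟩)).ne' hij
  · exact (weightRank_lt hc j.2 (Or.inl h)).ne hij

/-- The index `j` and its predecessors are `weightRank c j + 1` indices, each of weight at least `c
j`, and all weights together sum to `S`. -/
lemma weight_mul_rank_le {c : ℕ → ℝ} (h0 : ∀ j, 0 ≤ c j) {S : ℝ} (hc : HasSum c S) {j : ℕ}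
    (hj : 0 < c j) : c j * (weightRank c j + 1) ≤ S := by
  classical
  have hfin := finite_weightRank_set hc.summable hj
  have hnot : j ∉ hfin.toFinset := by simp
  have h1 : ∑ i ∈ insert j hfin.toFinset, c i ≤ S := sum_le_hasSum _ (fun i _ => h0 i) hc
  have h2 : (insert j hfin.toFinset).card • c j ≤ ∑ i ∈ insert j hfin.toFinset, c i := by
    refine Finset.card_nsmul_le_sum _ _ _ fun i hi => ?_
    rw [Finset.mem_insert, Set.Finite.mem_toFinset] at hi
    rcases hi with rfl | hi | hi
    · exact le_rfl
    · exact hi.le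
    · exact hi.1.ge
  rw [Finset.card_insert_of_notMem hnot, nsmul_eq_mul] at h2
  have h3 : weightRank c j = hfin.toFinset.card := Set.ncard_eq_toFinset_card _ hfin
  rw [h3]
  push_cast at h2
  linarith [mul_comm (c j) ((hfin.toFinset.card : ℝ) + 1)]

/-- Every density matrix comes from an orthogonal system with `‖φ_j‖² ≤ 1 / (j + 1)`. -/
theorem exists_orthSystem {M N : ℕ} {Γ : Hil M N →L[ℂ] Hil M N} (hΓ : Γ ∈ densityMatrices M N) :
    ∃ φ : ℕ → formDomain M N, IsOrthSystem φ ∧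
      (∀ j : ℕ, ‖(φ j : Hil M N)‖ ^ 2 * (j + 1) ≤ 1) ∧
      ∀ q : formDomain M N → ℂ, Admissible q → formTrace q Γ = ∑' j, q (φ j) := by
  obtain ⟨c, ψ, hs⟩ := hΓ
  have hc := hs.sum_one.summable
  set f : {j // 0 < c j} → ℕ := fun j => weightRank c j with hf
  have hinj : Function.Injective f := weightRank_injective hc
  set φ₀ : {j // 0 < c j} → formDomain M N := fun j => (Real.sqrt (c j) : ℂ) • ψ j with hφ₀
  -- Place the vectors of positive weight at their ranks and fill every unused position with 0.
  set φ : ℕ → formDomain M N := Function.extend f φ₀ 0 with hφ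
  have hf1 : ∀ j, φ (f j) = φ₀ j := fun j => hinj.extend_apply _ _ j
  have hf0 : ∀ k, k ∉ Set.range f → φ k = 0 := fun k hk => by
    rw [hφ, Function.extend_apply' _ _ _ (by simpa using hk)]; rfl
  have hsq : ∀ j : {j // 0 < c j}, ‖(Real.sqrt (c j) : ℂ)‖ ^ 2 = c j := fun j => by
    rw [Complex.norm_real, Real.norm_eq_abs, sq_abs, Real.sq_sqrt (hs.nonneg _)]
  have hψ1 : ∀ j, 0 < c j → ‖(ψ j : Hil M N)‖ = 1 := fun j hj => hs.orthonormal.1 ⟨j, hj.ne'⟩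
  have hnorm : ∀ j, ‖(φ₀ j : Hil M N)‖ ^ 2 = c j := fun j => by
    rw [hφ₀]
    simp only [Submodule.coe_smul]
    rw [norm_smul, mul_pow, hsq, hψ1 j j.2]
    ring
  have hsupp : ∀ {E : Type} [AddCommGroup E] (g : ℕ → E), (∀ j, c j = 0 → g j = 0) →
      ∀ j, j ∉ Set.range ((↑) : {j // 0 < c j} → ℕ) → g j = 0 := fun g hg j hj => by
    refine hg j (le_antisymm ?_ (hs.nonneg j))
    simpa using hj
  have hval : Function.Injective ((↑) : {j // 0 < c j} → ℕ) := Subtype.val_injective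
  refine ⟨φ, ⟨fun k l hkl => ?_, ?_, ?_⟩, fun k => ?_, fun q hq => ?_⟩
  · show ⟪(φ k : Hil M N), (φ l : Hil M N)⟫_ℂ = 0
    by_cases hk : k ∈ Set.range f
    · by_cases hl : l ∈ Set.range f
      · obtain ⟨i, rfl⟩ := hk
        obtain ⟨j, rfl⟩ := hl
        have hij : i ≠ j := fun e => hkl (by rw [e])
        have := hs.orthonormal.2 (i := ⟨i, i.2.ne'⟩) (j := ⟨j, j.2.ne'⟩)
          (fun e => hij (Subtype.ext (Subtype.mk.inj e)))
        simp only at this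
        rw [hf1, hf1]
        simp only [hφ₀, Submodule.coe_smul, inner_smul_left, inner_smul_right, this, mul_zero]
      · rw [hf0 l hl]; simp
    · rw [hf0 k hk]; simp
  · rw [← hinj.hasSum_iff (fun k hk => by rw [hf0 k hk]; simp)]
    have e : (fun k => ‖(φ k : Hil M N)‖ ^ 2) ∘ f = c ∘ (↑) := by
      funext j
      simp only [Function.comp_apply, hf1, hnorm]
    rw [e, hval.hasSum_iff (hsupp c fun _ h => h)]
    exact hs.sum_one
  · rw [← hinj.summable_iff (fun k hk => by rw [hf0 k hk]; simp [oscEnergy])]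
    have e : (fun k => oscEnergy (φ k)) ∘ f = (fun j => c j * oscEnergy (ψ j)) ∘ (↑) := by
      funext j
      simp only [Function.comp_apply, hf1, hφ₀, oscEnergy_smul, hsq]
    rw [e, hval.summable_iff (hsupp _ fun j h => by simp [h])]
    exact hs.finite_energy
  · by_cases hk : k ∈ Set.range f
    · obtain ⟨j, rfl⟩ := hk
      rw [hf1, hnorm]
      exact weight_mul_rank_le hs.nonneg hs.sum_one j.2
    · rw [hf0 k hk]; simp
  · rw [hs.formTrace_eq hq]
    have hq0 : q 0 = 0 := by simpa using hq.apply_smul 0 0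
    rw [← hval.tsum_eq (Function.support_subset_iff'.mpr (hsupp _ fun j h => by simp [h])),
      ← hinj.tsum_eq (Function.support_subset_iff'.mpr fun k hk => by rw [hf0 k hk, hq0])]
    refine tsum_congr fun j => ?_
    rw [hf1, hφ₀, hq.apply_smul, hsq]

/-! ### Position and momentum as distributions -/

section Distributions

open FourierTransform TemperedDistribution

lemma hasTemperateGrowth_coord {M : ℕ} (m : Fin M) :
    (fun x : Pos M => ((x m : ℝ) : ℂ)).HasTemperateGrowth := by
  have h : (fun x : Pos M => ((x m : ℝ) : ℂ)) =
      Complex.ofRealCLM ∘L (EuclideanSpace.proj m : Pos M →L[ℝ] ℝ) := by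
    funext x; simp
  rw [h]
  exact ContinuousLinearMap.hasTemperateGrowth _

/-- Smooth real bump functions already separate locally integrable functions, and each is a complex
Schwartz function. Keeping compact support in the hypothesis lets the lemma apply to functions that
are only locally integrable. -/
lemma ae_eq_of_schwartz {M N : ℕ} {f g : Pos M → Spin N} (hf : LocallyIntegrable f)
    (hg : LocallyIntegrable g)
    (h : ∀ η : 𝓢(Pos M, ℂ), HasCompactSupport η → ∫ x, η x • f x = ∫ x, η x • g x) :
    f =ᵐ[volume] g := by
  refine ae_eq_of_integral_contDiff_smul_eq hf hg fun η hη hc => ?_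
  have hc' : HasCompactSupport (Complex.ofRealCLM ∘ η) := hc.comp_left rfl
  have hη' : ContDiff ℝ (⊤ : ℕ∞) (Complex.ofRealCLM ∘ η) := by fun_prop
  have := h (hc'.toSchwartzMap hη') hc'
  simpa using this

/-- The distributional form of the relation is what passes to weak limits and what the Fourier
transform produces. In the reverse direction `x_m ψ` is a priori only locally integrable. -/
theorem isMulPos_iff {M N : ℕ} {m : Fin M} {ψ g : Hil M N} :
    IsMulPos m ψ g ↔ smulLeftCLM (Spin N) (fun x : Pos M => ((x m : ℝ) : ℂ))
      (ψ : 𝓢'(Pos M, Spin N)) = (g : 𝓢'(Pos M, Spin N)) := by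
  have ht := hasTemperateGrowth_coord m
  constructor
  · intro h
    ext1 η
    simp only [smulLeftCLM_apply_apply, Lp.toTemperedDistribution_apply]
    refine integral_congr_ae ?_
    filter_upwards [h] with x hx
    rw [hx, SchwartzMap.smulLeftCLM_apply_apply ht, smul_smul, smul_eq_mul, mul_comm]
  · intro h
    have hψ : LocallyIntegrable (ψ : Pos M → Spin N) :=
      (Lp.memLp ψ).locallyIntegrable (by norm_num)
    have hg : LocallyIntegrable (g : Pos M → Spin N) :=
      (Lp.memLp g).locallyIntegrable (by norm_num)
    have hxψ : LocallyIntegrable fun x : Pos M => ((x m : ℝ) : ℂ) • ψ x := by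
      rw [← locallyIntegrableOn_univ] at hψ ⊢
      exact hψ.continuousOn_smul isOpen_univ.isLocallyClosed (by fun_prop)
    refine ae_eq_of_schwartz hg hxψ fun η _ => ?_
    have h1 := congrArg (fun T : 𝓢'(Pos M, Spin N) => T η) h
    simp only [smulLeftCLM_apply_apply, Lp.toTemperedDistribution_apply] at h1
    rw [← h1]
    refine integral_congr_ae (Filter.Eventually.of_forall fun x => ?_)
    simp only
    rw [SchwartzMap.smulLeftCLM_apply_apply ht, smul_smul, smul_eq_mul, mul_comm]

/-- The Fourier transform turns `∂_m` into multiplication by `2πi ξ_m`, so the position cutoff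
estimate also controls the momentum tail. -/
theorem IsPartial.isMulPos_fourier {M N : ℕ} {m : Fin M} {ψ g : Hil M N} (h : IsPartial m ψ g) :
    IsMulPos m (𝓕 ψ) ((2 * Real.pi * Complex.I)⁻¹ • 𝓕 g) := by
  have hne : (2 * Real.pi * Complex.I : ℂ) ≠ 0 := by
    simp [Real.pi_ne_zero]
  rw [isMulPos_iff]
  have e : ∀ (a : ℂ) (b : Hil M N),
      ((a • b : Hil M N) : 𝓢'(Pos M, Spin N)) = a • (b : 𝓢'(Pos M, Spin N)) :=
    fun a b => map_smul (Lp.toTemperedDistributionCLM (Spin N) (volume : Measure (Pos M)) 2) a b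
  have h1 := congrArg (fun T : 𝓢'(Pos M, Spin N) => 𝓕 T) h
  simp only [TemperedDistribution.fourier_lineDerivOp_eq,
    Lp.fourier_toTemperedDistribution_eq] at h1
  rw [e, ← h1, smul_smul, inv_mul_cancel₀ hne, one_smul]
  congr 2
  funext x
  simp [EuclideanSpace.inner_single_right]

/-- The Fourier transform on `L²` is given by the Fourier integral on integrable functions. -/
theorem fourier_ae_eq {M N : ℕ} {u : Hil M N} (hu : Integrable (u : Pos M → Spin N)) :
    (𝓕 u : Hil M N) =ᵐ[volume] 𝓕 (u : Pos M → Spin N) := by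
  have hc : Continuous (𝓕 (u : Pos M → Spin N)) :=
    VectorFourier.fourierIntegral_continuous Real.continuous_fourierChar
      (by exact continuous_inner) hu
  refine ae_eq_of_schwartz ((Lp.memLp _).locallyIntegrable (by norm_num)) hc.locallyIntegrable
    fun η _ => ?_
  have h1 : ((𝓕 u : Hil M N) : 𝓢'(Pos M, Spin N)) η = (u : 𝓢'(Pos M, Spin N)) (𝓕 η) := by
    rw [← Lp.fourier_toTemperedDistribution_eq, TemperedDistribution.fourier_apply]
  rw [Lp.toTemperedDistribution_apply, Lp.toTemperedDistribution_apply] at h1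
  rw [h1]
  have := VectorFourier.integral_fourierIntegral_smul_eq_flip (μ := volume) (ν := volume)
    (L := innerₗ (Pos M)) Real.continuous_fourierChar continuous_inner η.integrable hu
  rw [flip_innerₗ] at this
  exact this

end Distributions

/-! ### Compactness of the embedding of the form domain -/

lemma integrable_norm_sq {M N : ℕ} (f : Hil M N) : Integrable fun x => ‖f x‖ ^ 2 :=
  (memLp_two_iff_integrable_sq_norm (Lp.aestronglyMeasurable f)).mp (Lp.memLp f)

lemma norm_sq_eq_integral {M N : ℕ} (f : Hil M N) : ‖f‖ ^ 2 = ∫ x, ‖f x‖ ^ 2 := by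
  have h : ((‖f‖ ^ 2 : ℝ) : ℂ) = ((∫ x, ‖f x‖ ^ 2 : ℝ) : ℂ) := by
    rw [← integral_complex_ofReal]
    have h1 : ((‖f‖ ^ 2 : ℝ) : ℂ) = ⟪f, f⟫_ℂ := by
      rw [inner_self_eq_norm_sq_to_K]; push_cast; rfl
    rw [h1, L2.inner_def]
    refine integral_congr_ae (Filter.Eventually.of_forall fun x => ?_)
    simp only
    rw [inner_self_eq_norm_sq_to_K]; push_cast; rfl
  exact_mod_cast h

/-- Multiplication by the indicator function of the ball of radius `R`, as a function. -/
def cutoffFun {M N : ℕ} (R : ℝ) (f : Hil M N) : Hil M N :=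
  MemLp.toLp _ ((Lp.memLp f).indicator
    (Metric.isClosed_closedBall (x := (0 : Pos M)) (ε := R)).measurableSet)

lemma coeFn_cutoffFun {M N : ℕ} (R : ℝ) (f : Hil M N) :
    cutoffFun R f =ᵐ[volume] (Metric.closedBall (0 : Pos M) R).indicator f :=
  MemLp.coeFn_toLp _

lemma cutoffFun_add {M N : ℕ} (R : ℝ) (f g : Hil M N) :
    cutoffFun R (f + g) = cutoffFun R f + cutoffFun R g := by
  refine Lp.ext ?_
  filter_upwards [coeFn_cutoffFun R (f + g), coeFn_cutoffFun R f, coeFn_cutoffFun R g,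
    Lp.coeFn_add f g, Lp.coeFn_add (cutoffFun R f) (cutoffFun R g)] with x h1 h2 h3 h4 h5
  rw [h1, h5, Pi.add_apply, h2, h3]
  by_cases hx : x ∈ Metric.closedBall (0 : Pos M) R
  · simp only [hx, Set.indicator_of_mem, h4, Pi.add_apply]
  · simp only [hx, not_false_eq_true, Set.indicator_of_notMem, add_zero]

lemma cutoffFun_smul {M N : ℕ} (R : ℝ) (a : ℂ) (f : Hil M N) :
    cutoffFun R (a • f) = a • cutoffFun R f := by
  refine Lp.ext ?_
  filter_upwards [coeFn_cutoffFun R (a • f), coeFn_cutoffFun R f, Lp.coeFn_smul a f,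
    Lp.coeFn_smul a (cutoffFun R f)] with x h1 h2 h3 h4
  rw [h1, h4, Pi.smul_apply, h2]
  by_cases hx : x ∈ Metric.closedBall (0 : Pos M) R
  · simp only [hx, Set.indicator_of_mem, h3, Pi.smul_apply]
  · simp only [hx, not_false_eq_true, Set.indicator_of_notMem, smul_zero]

lemma norm_cutoffFun_le {M N : ℕ} (R : ℝ) (f : Hil M N) : ‖cutoffFun R f‖ ≤ ‖f‖ := by
  refine Lp.norm_le_norm_of_ae_le ?_
  filter_upwards [coeFn_cutoffFun R f] with x hx
  rw [hx]
  exact norm_indicator_le_norm_self _ _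

/-- Multiplication by the indicator function of the ball of radius `R`. -/
def cutoff (M N : ℕ) (R : ℝ) : Hil M N →L[ℂ] Hil M N :=
  LinearMap.mkContinuous
    { toFun := cutoffFun R
      map_add' := cutoffFun_add R
      map_smul' := cutoffFun_smul R }
    1 fun f => (norm_cutoffFun_le R f).trans_eq (one_mul _).symm

lemma coeFn_cutoff {M N : ℕ} (R : ℝ) (f : Hil M N) :
    cutoff M N R f =ᵐ[volume] (Metric.closedBall (0 : Pos M) R).indicator f :=
  coeFn_cutoffFun R f

lemma norm_cutoff_le {M N : ℕ} (R : ℝ) (f : Hil M N) : ‖cutoff M N R f‖ ≤ ‖f‖ :=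
  norm_cutoffFun_le R f

/-- A Chebyshev bound: outside the ball, `1 ≤ |x|² / R²`. -/
lemma norm_sub_cutoff_sq_le {M N : ℕ} {R : ℝ} (hR : 0 < R) {f : Hil M N} {X : Fin M → Hil M N}
    (hX : ∀ m, IsMulPos m f (X m)) :
    ‖f - cutoff M N R f‖ ^ 2 ≤ (R ^ 2)⁻¹ * ∑ m, ‖X m‖ ^ 2 := by
  simp only [norm_sq_eq_integral]
  rw [← integral_finsetSum _ fun m _ => integrable_norm_sq (X m), ← integral_const_mul]
  refine integral_mono_ae (integrable_norm_sq _)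
    ((integrable_finsetSum _ fun m _ => integrable_norm_sq (X m)).const_mul _) ?_
  filter_upwards [coeFn_cutoff R f, Lp.coeFn_sub f (cutoff M N R f),
    ae_all_iff.mpr hX] with x h1 h2 h3
  rw [h2, Pi.sub_apply, h1]
  simp only [h3, norm_smul, Complex.norm_real, mul_pow, Real.norm_eq_abs, sq_abs]
  rw [← Finset.sum_mul]
  have hx : ‖x‖ ^ 2 = ∑ m, x m ^ 2 := by
    rw [EuclideanSpace.norm_sq_eq]; simp
  rw [← hx]
  by_cases hb : x ∈ Metric.closedBall (0 : Pos M) R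
  · simp only [hb, Set.indicator_of_mem, sub_self, norm_zero]
    rw [zero_pow two_ne_zero]; positivity
  · simp only [hb, not_false_eq_true, Set.indicator_of_notMem, sub_zero]
    rw [← mul_assoc]
    refine le_mul_of_one_le_left (by positivity) ?_
    have hb' : R < ‖x‖ := by simpa using hb
    rw [inv_mul_eq_div, one_le_div (by positivity)]
    gcongr

/-! ### Phase space localization and the compactness estimate -/

section Fourier

open FourierTransform

/-- The plane wave `x ↦ e^{2πi⟨x, ξ⟩} e_α` restricted to the ball of radius `R`. -/
def planeWave {M N : ℕ} (R : ℝ) (ξ : Pos M) (α : Fin N → Fin 2) : Pos M → Spin N :=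
  (Metric.closedBall (0 : Pos M) R).indicator fun x =>
    (Real.fourierChar ⟪x, ξ⟫_ℝ : ℂ) • EuclideanSpace.single α (1 : ℂ)

lemma memLp_planeWave {M N : ℕ} (R : ℝ) (ξ : Pos M) (α : Fin N → Fin 2) :
    MemLp (planeWave R ξ α) 2 := by
  rw [planeWave, memLp_indicator_iff_restrict Metric.isClosed_closedBall.measurableSet]
  have : IsFiniteMeasure ((volume : Measure (Pos M)).restrict (Metric.closedBall 0 R)) :=
    ⟨by simpa using (isCompact_closedBall (0 : Pos M) R).measure_lt_top⟩
  refine MemLp.of_bound (Continuous.aestronglyMeasurable ?_) 1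
    (Filter.Eventually.of_forall fun x => ?_)
  · have : Continuous fun x : Pos M => (Real.fourierChar ⟪x, ξ⟫_ℝ : ℂ) :=
      continuous_subtype_val.comp (Real.continuous_fourierChar.comp (by fun_prop))
    exact this.smul continuous_const
  · rw [norm_smul, Circle.norm_coe]; simp

/-- The truncated plane wave as an element of `L²`. -/
def planeWaveLp {M N : ℕ} (R : ℝ) (ξ : Pos M) (α : Fin N → Fin 2) : Hil M N :=
  MemLp.toLp _ (memLp_planeWave R ξ α)

lemma coeFn_planeWaveLp {M N : ℕ} (R : ℝ) (ξ : Pos M) (α : Fin N → Fin 2) :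
    planeWaveLp R ξ α =ᵐ[volume] planeWave R ξ α :=
  MemLp.coeFn_toLp _

lemma norm_planeWave_sq_le {M N : ℕ} (R : ℝ) (ξ : Pos M) (α : Fin N → Fin 2) :
    ‖planeWaveLp R ξ α‖ ^ 2 ≤ volume.real (Metric.closedBall (0 : Pos M) R) := by
  rw [norm_sq_eq_integral]
  have h : ∀ᵐ x, ‖planeWaveLp R ξ α x‖ ^ 2 =
      (Metric.closedBall (0 : Pos M) R).indicator (fun _ => (1 : ℝ)) x := by
    filter_upwards [coeFn_planeWaveLp R ξ α] with x hx
    rw [hx, planeWave]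
    by_cases hb : x ∈ Metric.closedBall (0 : Pos M) R
    · simp only [hb, Set.indicator_of_mem, norm_smul, Circle.norm_coe]; simp
    · simp [hb]
  rw [integral_congr_ae h, integral_indicator Metric.isClosed_closedBall.measurableSet]
  simp

/-- Conjugation in the first slot turns the plane wave into the Fourier kernel. Values of the
truncated transform are thereby inner products, open to Bessel's inequality. -/
lemma fourier_cutoff_apply {M N : ℕ} (R : ℝ) (f : Hil M N) (ξ : Pos M) (α : Fin N → Fin 2) :
    (𝓕 (cutoff M N R f : Pos M → Spin N) ξ) α = ⟪planeWaveLp R ξ α, f⟫_ℂ := by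
  have hint : Integrable (cutoff M N R f : Pos M → Spin N) := by
    refine (integrable_congr (coeFn_cutoff R f)).mpr ?_
    refine (integrable_indicator_iff Metric.isClosed_closedBall.measurableSet).mpr ?_
    exact ((Lp.memLp f).locallyIntegrable (by norm_num)).integrableOn_isCompact
      (isCompact_closedBall _ _)
  have hint' : Integrable fun x => Real.fourierChar (-⟪x, ξ⟫_ℝ) • cutoff M N R f x :=
    (Real.fourierIntegral_convergent_iff ξ).mpr hint
  have h1 := (EuclideanSpace.proj α : Spin N →L[ℂ] ℂ).integral_comp_comm hint'
  simp only [PiLp.proj_apply] at h1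
  rw [Real.fourier_eq, ← h1, L2.inner_def]
  refine integral_congr_ae ?_
  filter_upwards [coeFn_planeWaveLp R ξ α, coeFn_cutoff R f] with x hx hx'
  rw [hx, hx', planeWave]
  by_cases hb : x ∈ Metric.closedBall (0 : Pos M) R
  · simp only [hb, Set.indicator_of_mem, inner_smul_left]
    rw [EuclideanSpace.inner_single_left, AddChar.map_neg_eq_inv, Circle.smul_def,
      Circle.coe_inv_eq_conj]
    simp
  · simp [hb]

/-- The operator `χ 𝓕 χ` with the indicator function `χ` of a ball. -/
def phaseCutoff (M N : ℕ) (R : ℝ) : Hil M N →L[ℂ] Hil M N :=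
  (cutoff M N R).comp ((fourierCLM ℂ (Hil M N)).comp (cutoff M N R))

lemma norm_phaseCutoff_sq {M N : ℕ} (R : ℝ) (f : Hil M N) :
    ∀ᵐ ξ, ‖phaseCutoff M N R f ξ‖ ^ 2 = (Metric.closedBall (0 : Pos M) R).indicator
      (fun ξ => ∑ α, ‖⟪planeWaveLp R ξ α, f⟫_ℂ‖ ^ 2) ξ := by
  have hint : Integrable (cutoff M N R f : Pos M → Spin N) := by
    refine (integrable_congr (coeFn_cutoff R f)).mpr ?_
    refine (integrable_indicator_iff Metric.isClosed_closedBall.measurableSet).mpr ?_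
    exact ((Lp.memLp f).locallyIntegrable (by norm_num)).integrableOn_isCompact
      (isCompact_closedBall _ _)
  filter_upwards [coeFn_cutoff R (𝓕 (cutoff M N R f)), fourier_ae_eq hint] with ξ h1 h2
  have h3 : phaseCutoff M N R f = cutoff M N R (𝓕 (cutoff M N R f)) := rfl
  rw [h3, h1]
  by_cases hb : ξ ∈ Metric.closedBall (0 : Pos M) R
  · simp only [hb, Set.indicator_of_mem]
    rw [h2, EuclideanSpace.norm_sq_eq]
    simp only [fourier_cutoff_apply]
  · simp [hb]

/-- The operator `χ 𝓕 χ` is Hilbert–Schmidt. -/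
theorem summable_norm_phaseCutoff {M N : ℕ} (R : ℝ) {ι : Type*} (b : HilbertBasis ι ℂ (Hil M N)) :
    Summable fun i => ‖phaseCutoff M N R (b i)‖ ^ 2 := by
  set V := volume.real (Metric.closedBall (0 : Pos M) R) with hV
  refine summable_of_sum_le (c := ∫ _ in Metric.closedBall (0 : Pos M) R,
    ∑ _α : Fin N → Fin 2, V) (fun _ => by positivity) fun F => ?_
  simp only [norm_sq_eq_integral]
  rw [← integral_finsetSum _ fun m _ => integrable_norm_sq _,
    ← integral_indicator Metric.isClosed_closedBall.measurableSet]
  refine integral_mono_ae (integrable_finsetSum _ fun m _ => integrable_norm_sq _) ?_ ?_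
  · refine (integrable_indicator_iff Metric.isClosed_closedBall.measurableSet).mpr ?_
    exact integrableOn_const (isCompact_closedBall (0 : Pos M) R).measure_lt_top.ne
  · have h : ∀ᵐ ξ, ∀ i ∈ F, ‖phaseCutoff M N R (b i) ξ‖ ^ 2 = _ :=
      (ae_ball_iff F.countable_toSet).mpr fun i _ => norm_phaseCutoff_sq R (b i)
    filter_upwards [h] with ξ hξ
    rw [Finset.sum_congr rfl hξ]
    by_cases hb : ξ ∈ Metric.closedBall (0 : Pos M) R
    · simp only [hb, Set.indicator_of_mem]
      rw [Finset.sum_comm]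
      refine Finset.sum_le_sum fun α _ => ?_
      refine le_trans ?_ (norm_planeWave_sq_le R ξ α)
      -- At fixed frequency, Bessel's inequality bounds the sum over the basis by the squared norm
      -- of the truncated plane wave, hence by the volume of the ball.
      simp only [norm_inner_symm _ (b _)]
      exact b.orthonormal.sum_inner_products_le _
    · simp [hb]

/-- The form norm controls the norm up to finitely many directions. -/
theorem exists_finset_norm_sq_le (M N : ℕ) {ε : ℝ} (hε : 0 < ε) :
    ∃ (F : Finset (Hil M N)) (C : ℝ), 0 ≤ C ∧ ∀ ψ : formDomain M N,
      ‖(ψ : Hil M N)‖ ^ 2 ≤ ε * (‖(ψ : Hil M N)‖ ^ 2 + oscEnergy ψ)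
        + C * ∑ b ∈ F, ‖⟪b, (ψ : Hil M N)⟫_ℂ‖ ^ 2 := by
  obtain ⟨w, b, hb⟩ := exists_hilbertBasis ℂ (Hil M N)
  -- The vector is split into three pieces; squaring the sum costs a factor 3, so each piece may
  -- contribute `ε / 3`. The constant 6 below is this 3 times the 2 of the Hilbert–Schmidt estimate.
  set R : ℝ := Real.sqrt (3 / ε) with hR
  have hR0 : 0 < R := Real.sqrt_pos.mpr (by positivity)
  have hRi : (R ^ 2)⁻¹ = ε / 3 := by
    rw [hR, Real.sq_sqrt (by positivity), inv_div]
  obtain ⟨F, hF⟩ := exists_finset_norm_apply_le b (phaseCutoff M N R)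
    (summable_norm_phaseCutoff R b) (ε := ε / 3) (by positivity)
  refine ⟨F.map ⟨Subtype.val, Subtype.val_injective⟩, 6 * ‖phaseCutoff M N R‖ ^ 2, by positivity,
    fun ψ => ?_⟩
  rw [Finset.sum_map]
  simp only [Function.Embedding.coeFn_mk]
  have h0 := hF ψ
  simp only [hb] at h0
  set f := (ψ : Hil M N) with hf
  have h1 : ‖f - cutoff M N R f‖ ^ 2 ≤ ε / 3 * ∑ m, ‖mulPos m ψ‖ ^ 2 := by
    rw [← hRi]
    exact norm_sub_cutoff_sq_le hR0 fun m => isMulPos_mulPos m ψ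
  have h2 : ‖𝓕 f - cutoff M N R (𝓕 f)‖ ^ 2 ≤ ε / 3 * ∑ m, ‖partialD m ψ‖ ^ 2 := by
    rw [← hRi]
    refine (norm_sub_cutoff_sq_le hR0 fun m => (isPartial_partialD m ψ).isMulPos_fourier).trans ?_
    gcongr with m
    rw [norm_smul, Lp.norm_fourier_eq]
    refine mul_le_of_le_one_left (norm_nonneg _) ?_
    rw [norm_inv]
    refine inv_le_one_of_one_le₀ ?_
    simp only [norm_mul, Complex.norm_ofNat, Complex.norm_real, Complex.norm_I, mul_one,
      Real.norm_of_nonneg Real.pi_pos.le]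
    linarith [Real.pi_gt_three]
  have h3 : ‖f‖ ≤ ‖𝓕 f - cutoff M N R (𝓕 f)‖ + ‖f - cutoff M N R f‖ + ‖phaseCutoff M N R f‖ := by
    -- That is, `𝓕 = (1 - χ)𝓕 + χ𝓕(1 - χ) + χ𝓕χ`: momentum tail, position tail, compact part.
    have e : 𝓕 f = (𝓕 f - cutoff M N R (𝓕 f)) + cutoff M N R (𝓕 (f - cutoff M N R f))
        + phaseCutoff M N R f := by
      have e1 : 𝓕 (f - cutoff M N R f) = 𝓕 f - 𝓕 (cutoff M N R f) :=
        map_sub (fourierCLM ℂ (Hil M N)) _ _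
      have e2 : phaseCutoff M N R f = cutoff M N R (𝓕 (cutoff M N R f)) := rfl
      rw [e1, e2, map_sub]
      abel
    calc ‖f‖ = ‖𝓕 f‖ := (Lp.norm_fourier_eq f).symm
      _ ≤ _ := by
        conv_lhs => rw [e]
        refine norm_add₃_le.trans ?_
        gcongr
        exact (norm_cutoff_le _ _).trans (Lp.norm_fourier_eq _).le
  have h4 : oscEnergy ψ = ∑ m, ‖partialD m ψ‖ ^ 2 + ∑ m, ‖mulPos m ψ‖ ^ 2 :=
    Finset.sum_add_distrib
  have h5 : ‖f‖ ^ 2 ≤ 3 * (‖𝓕 f - cutoff M N R (𝓕 f)‖ ^ 2 + ‖f - cutoff M N R f‖ ^ 2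
      + ‖phaseCutoff M N R f‖ ^ 2) := by
    set x := ‖𝓕 f - cutoff M N R (𝓕 f)‖
    set y := ‖f - cutoff M N R f‖
    set z := ‖phaseCutoff M N R f‖
    have : ‖f‖ ^ 2 ≤ (x + y + z) ^ 2 := by gcongr
    nlinarith [sq_nonneg (x - y), sq_nonneg (y - z), sq_nonneg (x - z)]
  rw [h4]
  linarith

end Fourier

/-! ### A trial state with prescribed magnetization and displacement -/

/-- The product vector `⊗_k (w_k(0), w_k(1))`. -/
def productSpin {N : ℕ} (w : Fin N → Fin 2 → ℝ) : Spin N :=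
  WithLp.toLp 2 fun α => ((∏ k, w k (α k) : ℝ) : ℂ)

/-- Distributivity: a product over sites of sums over two spin values is the sum over all
multi-indices. -/
lemma inner_productSpin {N : ℕ} (w w' : Fin N → Fin 2 → ℝ) :
    ⟪productSpin w, productSpin w'⟫_ℂ = ((∏ k, ∑ a, w k a * w' k a : ℝ) : ℂ) := by
  rw [PiLp.inner_apply, Finset.prod_univ_sum, Fintype.piFinset_univ]
  push_cast
  refine Finset.sum_congr rfl fun α _ => ?_
  rw [Finset.prod_mul_distrib]
  simp [productSpin, mul_comm]

lemma toEuclideanCLM_lift_productSpin {N : ℕ} (n : Fin N) (w : Fin N → Fin 2 → ℝ) :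
    Matrix.toEuclideanCLM (n := Fin N → Fin 2) (𝕜 := ℂ) (lift n pauliZ) (productSpin w)
      = productSpin fun k a => (if k = n then (if a = 0 then 1 else -1) else 1) * w k a := by
  ext α
  rw [Matrix.ofLp_toEuclideanCLM]
  simp only [Matrix.mulVec, dotProduct, lift, Matrix.of_apply, productSpin]
  push_cast
  simp only [← Finset.prod_mul_distrib]
  rw [← Fintype.piFinset_univ, ← Finset.prod_univ_sum (fun _ => Finset.univ)
    (fun k b => (if k = n then pauliZ else 1) (α k) b * (w k b : ℂ))]
  refine Finset.prod_congr rfl fun k _ => ?_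
  generalize α k = a
  by_cases hk : k = n
  · fin_cases a <;> simp [hk, pauliZ]
  · simp [hk, Matrix.one_apply]

/-- The amplitudes of a spin with magnetization `s`. -/
def spinAmplitude (s : ℝ) (a : Fin 2) : ℝ :=
  if a = 0 then Real.sqrt ((1 + s) / 2) else Real.sqrt ((1 - s) / 2)

lemma spinAmplitude_sq {s : ℝ} (hs : s ∈ Set.Icc (-1 : ℝ) 1) :
    spinAmplitude s 0 * spinAmplitude s 0 = (1 + s) / 2 ∧
      spinAmplitude s 1 * spinAmplitude s 1 = (1 - s) / 2 := by
  constructor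
  · simp only [spinAmplitude, if_true]
    exact Real.mul_self_sqrt (by linarith [hs.1])
  · simp only [spinAmplitude, one_ne_zero, if_false]
    exact Real.mul_self_sqrt (by linarith [hs.2])

/-- Every `σ ∈ [-1, 1]^N` is the magnetization of a unit vector. -/
lemma exists_spin_vector {N : ℕ} {σ : Fin N → ℝ} (hσ : ∀ n, σ n ∈ Set.Icc (-1 : ℝ) 1) :
    ∃ v : Spin N, ⟪v, v⟫_ℂ = 1 ∧ ∀ n,
      ⟪v, Matrix.toEuclideanCLM (n := Fin N → Fin 2) (𝕜 := ℂ) (lift n pauliZ) v⟫_ℂ = (σ n : ℂ) := by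
  have hsq := fun k => spinAmplitude_sq (hσ k)
  refine ⟨productSpin fun k => spinAmplitude (σ k), ?_, fun n => ?_⟩
  · rw [inner_productSpin, Finset.prod_eq_one fun k _ => ?_]
    · simp
    · rw [Fin.sum_univ_two, (hsq k).1, (hsq k).2]; ring
  · rw [toEuclideanCLM_lift_productSpin, inner_productSpin, Finset.prod_eq_single n]
    · refine congrArg Complex.ofReal ?_
      rw [Fin.sum_univ_two]
      simp only [if_true, one_ne_zero, if_false, one_mul, neg_mul, mul_neg, (hsq n).1, (hsq n).2]
      ring
    · intro k _ hk
      rw [Fin.sum_univ_two]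
      simp only [hk, if_false, one_mul, (hsq k).1, (hsq k).2]
      ring
    · simp

lemma schwartz_mem_formDomain {M N : ℕ} (s : 𝓢(Pos M, Spin N)) : s.toLp 2 volume ∈ formDomain M N := by
  intro m
  refine ⟨⟨(∂_{(EuclideanSpace.single m (1 : ℝ) : Pos M)} s).toLp 2 volume, ?_⟩,
    (SchwartzMap.smulLeftCLM (Spin N) (fun x : Pos M => ((x m : ℝ) : ℂ)) s).toLp 2 volume, ?_⟩
  · unfold IsPartial
    rw [Lp.toTemperedDistribution_toLp_eq, Lp.toTemperedDistribution_toLp_eq,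
      TemperedDistribution.lineDerivOp_toTemperedDistributionCLM_eq]
  · filter_upwards [s.coeFn_toLp 2 volume, (SchwartzMap.smulLeftCLM (Spin N)
      (fun x : Pos M => ((x m : ℝ) : ℂ)) s).coeFn_toLp 2 volume] with x h1 h2
    rw [h1, h2, SchwartzMap.smulLeftCLM_apply_apply (hasTemperateGrowth_coord m)]

lemma integral_odd_eq_zero {M : ℕ} {h : Pos M → ℝ} (hh : ∀ x, h (-x) = - h x) : ∫ x, h x = 0 := by
  have h1 := integral_neg_eq_self h (volume : Measure (Pos M))
  simp only [hh, integral_neg] at h1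
  linarith

/-- Take a bump function centred at ξ times a spin vector of magnetization σ. The spin expectation
factors out, the symmetry of the bump about its centre makes ξ the mean position, and division by
`√I` normalizes. -/
theorem exists_trial_state {M N : ℕ} {σ : Fin N → ℝ} (hσ : ∀ n, σ n ∈ Set.Icc (-1 : ℝ) 1)
    (ξ : Fin M → ℝ) : ∃ ψ : formDomain M N, ‖(ψ : Hil M N)‖ = 1 ∧ (∀ n, magForm n ψ = (σ n : ℂ)) ∧
      ∀ m, dispForm m ψ = (ξ m : ℂ) := by
  obtain ⟨v, hv, hvσ⟩ := exists_spin_vector hσ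
  set c : Pos M := WithLp.toLp 2 ξ with hc
  let f : ContDiffBump c := ⟨1, 2, one_pos, one_lt_two⟩
  have hs1 : HasCompactSupport fun x : Pos M => (f x : ℂ) • v :=
    (f.hasCompactSupport.comp_left (g := fun r : ℝ => (r : ℂ) • v) (by simp))
  have hs2 : ContDiff ℝ (⊤ : ℕ∞) fun x : Pos M => (f x : ℂ) • v :=
    ((Complex.ofRealCLM.contDiff.comp f.contDiff).smul contDiff_const)
  set s : 𝓢(Pos M, Spin N) := hs1.toSchwartzMap hs2 with hs
  have hsx : ∀ x, s x = (f x : ℂ) • v := fun x => rfl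
  set ψ₀ : formDomain M N := ⟨s.toLp 2 volume, schwartz_mem_formDomain s⟩ with hψ₀
  have hψx : ∀ᵐ x, (ψ₀ : Hil M N) x = (f x : ℂ) • v := s.coeFn_toLp 2 volume
  set I : ℝ := ∫ x, f x ^ 2 with hI
  have hfc : Continuous fun x => f x ^ 2 := f.continuous.pow 2
  have hsupp : HasCompactSupport fun x => f x ^ 2 :=
    f.hasCompactSupport.comp_left (g := fun r : ℝ => r ^ 2) (by simp)
  have hI0 : 0 < I := hfc.integral_pos_of_hasCompactSupport_nonneg_nonzero hsupp
    (fun x => sq_nonneg _) (x := c) (by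
      rw [f.one_of_mem_closedBall (by simp [f.rIn_pos.le])]; norm_num)
  have hnorm : ‖(ψ₀ : Hil M N)‖ ^ 2 = I := by
    rw [norm_sq_eq_integral, hI]
    refine integral_congr_ae ?_
    filter_upwards [hψx] with x hx
    have hv1 : ‖v‖ ^ 2 = 1 := by
      have : ((‖v‖ ^ 2 : ℝ) : ℂ) = 1 := by
        rw [← hv, inner_self_eq_norm_sq_to_K]; push_cast; rfl
      exact_mod_cast this
    rw [hx, norm_smul, mul_pow, hv1, Complex.norm_real, Real.norm_eq_abs, sq_abs, mul_one]
  have hmag : ∀ n, magForm n ψ₀ = (I : ℂ) * σ n := fun n => by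
    rw [magForm, L2.inner_def, hI, ← integral_complex_ofReal, ← integral_mul_const]
    refine integral_congr_ae ?_
    filter_upwards [hψx, ContinuousLinearMap.coeFn_compLpL (p := 2) (μ := volume)
      (Matrix.toEuclideanCLM (n := Fin N → Fin 2) (𝕜 := ℂ) (lift n pauliZ))
      (ψ₀ : Hil M N)] with x h1 h2
    have h3 : (sigmaZ M n ψ₀) x = _ := h2
    rw [h3, h1, map_smul, inner_smul_left, inner_smul_right, hvσ, Complex.conj_ofReal]
    push_cast
    ring
  have hdisp : ∀ m, dispForm m ψ₀ = (I : ℂ) * ξ m := fun m => by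
    have e1 : dispForm m ψ₀ = ((∫ x : Pos M, f x ^ 2 * x m : ℝ) : ℂ) := by
      rw [dispForm, L2.inner_def, ← integral_complex_ofReal]
      refine integral_congr_ae ?_
      filter_upwards [hψx, isMulPos_mulPos m ψ₀] with x h1 h2
      rw [h2, h1, inner_smul_left, inner_smul_right, inner_smul_right, hv, Complex.conj_ofReal]
      push_cast
      ring
    have hi1 : Integrable fun x => f x ^ 2 := hfc.integrable_of_hasCompactSupport hsupp
    have hi2 : Integrable fun x : Pos M => f x ^ 2 * x m :=
      (hfc.mul (by fun_prop)).integrable_of_hasCompactSupport hsupp.mul_right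
    have e2 : ∫ x : Pos M, (f x ^ 2 * x m - f x ^ 2 * ξ m) = 0 := by
      -- Recentred at `c`, the integrand is an even function times a coordinate, hence odd.
      rw [← integral_add_left_eq_self _ c]
      refine integral_odd_eq_zero fun x => ?_
      have h1 : f (c + -x) = f (c + x) := by rw [← sub_eq_add_neg, f.sub]
      rw [h1]
      simp [hc]
      ring
    rw [integral_sub hi2 (hi1.mul_const _), integral_mul_const, sub_eq_zero] at e2
    rw [e1, e2, hI]
    push_cast
    rfl
  have hr : ‖((Real.sqrt I)⁻¹ : ℂ)‖ ^ 2 = I⁻¹ := by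
    rw [norm_inv, Complex.norm_real, Real.norm_of_nonneg (Real.sqrt_nonneg _), inv_pow,
      Real.sq_sqrt hI0.le]
  have hIC : (I : ℂ) ≠ 0 := by exact_mod_cast hI0.ne'
  refine ⟨((Real.sqrt I)⁻¹ : ℂ) • ψ₀, ?_, fun n => ?_, fun m => ?_⟩
  · have h : ‖((((Real.sqrt I)⁻¹ : ℂ) • ψ₀ : formDomain M N) : Hil M N)‖ ^ 2 = 1 := by
      rw [Submodule.coe_smul, norm_smul, mul_pow, hr, hnorm, inv_mul_cancel₀ hI0.ne']
    exact (pow_eq_one_iff_of_nonneg (norm_nonneg _) two_ne_zero).mp h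
  · rw [(admissible_magForm n).apply_smul, hr, hmag]
    push_cast
    rw [← mul_assoc, inv_mul_cancel₀ hIC, one_mul]
  · rw [(admissible_dispForm m).apply_smul, hr, hdisp]
    push_cast
    rw [← mul_assoc, inv_mul_cancel₀ hIC, one_mul]

/-! ### Compactness of orthogonal systems of bounded energy -/

section Compactness

open Filter Topology

lemma weak_limit_map {H H' : Type*} [NormedAddCommGroup H] [InnerProductSpace ℂ H]
    [CompleteSpace H] [NormedAddCommGroup H'] [InnerProductSpace ℂ H'] [CompleteSpace H']
    {ι : Type*} {U : Ultrafilter ι} {u : ι → H} {v : H} (T : H →L[ℂ] H')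
    (h : ∀ w, Tendsto (fun k => ⟪w, u k⟫_ℂ) U (𝓝 ⟪w, v⟫_ℂ)) (w : H') :
    Tendsto (fun k => ⟪w, T (u k)⟫_ℂ) U (𝓝 ⟪w, T v⟫_ℂ) := by
  simpa only [ContinuousLinearMap.adjoint_inner_left] using h (ContinuousLinearMap.adjoint T w)

/-- The pairing of `L²` functions with a Schwartz function. -/
def testCLM {M N : ℕ} (η : 𝓢(Pos M, ℂ)) : Hil M N →L[ℂ] Spin N :=
  (PointwiseConvergenceCLM.evalCLM (RingHom.id ℂ) (Spin N) η).comp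
    (Lp.toTemperedDistributionCLM (Spin N) (volume : Measure (Pos M)) 2)

lemma testCLM_apply {M N : ℕ} (η : 𝓢(Pos M, ℂ)) (f : Hil M N) :
    testCLM η f = (f : 𝓢'(Pos M, Spin N)) η := rfl

variable {M N : ℕ} {ι : Type*} {U : Ultrafilter ι}

/-- Pairing with a fixed Schwartz function is a bounded operator on L², so both sides of the
distributional identity pass to the weak limit. -/
lemma IsPartial.of_weak_limit {m : Fin M} {ψ g : ι → Hil M N} {ψ₀ g₀ : Hil M N}
    (h : ∀ k, IsPartial m (ψ k) (g k))
    (hψ : ∀ w, Tendsto (fun k => ⟪w, ψ k⟫_ℂ) U (𝓝 ⟪w, ψ₀⟫_ℂ))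
    (hg : ∀ w, Tendsto (fun k => ⟪w, g k⟫_ℂ) U (𝓝 ⟪w, g₀⟫_ℂ)) : IsPartial m ψ₀ g₀ := by
  unfold IsPartial
  ext1 η
  rw [TemperedDistribution.lineDerivOp_apply_apply, ← testCLM_apply, ← testCLM_apply]
  refine weak_limit_unique (weak_limit_map _ hψ) fun w => ?_
  have e : ∀ k, testCLM (-∂_{(EuclideanSpace.single m (1 : ℝ) : Pos M)} η) (ψ k)
      = testCLM η (g k) := fun k =>
    congrArg (fun T : 𝓢'(Pos M, Spin N) => T η) (h k)
  simp only [e]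
  exact weak_limit_map (testCLM η) hg w

lemma IsMulPos.of_weak_limit {m : Fin M} {ψ g : ι → Hil M N} {ψ₀ g₀ : Hil M N}
    (h : ∀ k, IsMulPos m (ψ k) (g k))
    (hψ : ∀ w, Tendsto (fun k => ⟪w, ψ k⟫_ℂ) U (𝓝 ⟪w, ψ₀⟫_ℂ))
    (hg : ∀ w, Tendsto (fun k => ⟪w, g k⟫_ℂ) U (𝓝 ⟪w, g₀⟫_ℂ)) : IsMulPos m ψ₀ g₀ := by
  rw [isMulPos_iff]
  ext1 η
  rw [TemperedDistribution.smulLeftCLM_apply_apply, ← testCLM_apply, ← testCLM_apply]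
  refine weak_limit_unique (weak_limit_map _ hψ) fun w => ?_
  have e : ∀ k, testCLM (SchwartzMap.smulLeftCLM ℂ (fun x : Pos M => ((x m : ℝ) : ℂ)) η) (ψ k)
      = testCLM η (g k) := fun k =>
    congrArg (fun T : 𝓢'(Pos M, Spin N) => T η) (isMulPos_iff.mp (h k))
  simp only [e]
  exact weak_limit_map (testCLM η) hg w

lemma norm_sub_sq_le {E : Type*} [NormedAddCommGroup E] (a b : E) :
    ‖a - b‖ ^ 2 ≤ 2 * (‖a‖ ^ 2 + ‖b‖ ^ 2) :=
  (pow_le_pow_left₀ (norm_nonneg _) (norm_sub_le a b) 2).trans add_sq_le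

lemma oscEnergy_sub_le (ψ χ : formDomain M N) :
    oscEnergy (ψ - χ) ≤ 2 * (oscEnergy ψ + oscEnergy χ) := by
  unfold oscEnergy
  rw [← Finset.sum_add_distrib, Finset.mul_sum]
  refine Finset.sum_le_sum fun m _ => ?_
  rw [map_sub, map_sub]
  have h1 := norm_sub_sq_le (partialD m ψ) (partialD m χ)
  have h2 := norm_sub_sq_le (mulPos m ψ) (mulPos m χ)
  linarith

/-- The embedding of the form domain is compact: weak convergence of a bounded family in the form
domain implies strong convergence in `L²`. -/
theorem tendsto_of_weak_limit {ψ : ι → formDomain M N} {ψ₀ : formDomain M N} {C : ℝ}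
    (hC : ∀ k, ‖(ψ k : Hil M N)‖ ^ 2 + oscEnergy (ψ k) ≤ C)
    (hψ : ∀ w, Tendsto (fun k => ⟪w, (ψ k : Hil M N)⟫_ℂ) U (𝓝 ⟪w, (ψ₀ : Hil M N)⟫_ℂ)) :
    Tendsto (fun k => (ψ k : Hil M N)) U (𝓝 (ψ₀ : Hil M N)) := by
  set C' := 2 * (C + (‖(ψ₀ : Hil M N)‖ ^ 2 + oscEnergy ψ₀)) with hC'
  have hd : ∀ k, ‖((ψ k - ψ₀ : formDomain M N) : Hil M N)‖ ^ 2 + oscEnergy (ψ k - ψ₀) ≤ C' :=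
    fun k => by
      have h1 := norm_sub_sq_le (ψ k : Hil M N) ψ₀
      have h2 := oscEnergy_sub_le (ψ k) ψ₀
      have h3 := hC k
      rw [Submodule.coe_sub]
      linarith
  have h0 : Tendsto (fun k => ‖(ψ k : Hil M N) - ψ₀‖ ^ 2) U (𝓝 0) := by
    rw [Metric.tendsto_nhds]
    intro δ hδ
    -- This ε makes the form norm term at most `δ / 2`; the remaining finitely many inner products
    -- tend to 0 by weak convergence.
    obtain ⟨F, c, hc0, hc⟩ := exists_finset_norm_sq_le M N (ε := δ / (2 * (|C'| + 1)))
      (by positivity)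
    have hlim : Tendsto (fun k => c * ∑ b ∈ F, ‖⟪b, (ψ k : Hil M N) - ψ₀⟫_ℂ‖ ^ 2) U (𝓝 0) := by
      have h1 : ∀ b : Hil M N, Tendsto (fun k => ‖⟪b, (ψ k : Hil M N) - ψ₀⟫_ℂ‖ ^ 2) U (𝓝 0) :=
        fun b => by
          have := ((hψ b).sub_const ⟪b, (ψ₀ : Hil M N)⟫_ℂ).norm.pow 2
          simpa [inner_sub_right] using this
      simpa using (tendsto_finsetSum F fun b _ => h1 b).const_mul c
    filter_upwards [hlim.eventually_lt_const (half_pos hδ)] with k hk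
    rw [Real.dist_eq, sub_zero, abs_of_nonneg (sq_nonneg _)]
    have h1 := hc (ψ k - ψ₀)
    have h2 : δ / (2 * (|C'| + 1)) * (‖((ψ k - ψ₀ : formDomain M N) : Hil M N)‖ ^ 2
        + oscEnergy (ψ k - ψ₀)) ≤ δ / 2 := by
      calc _ ≤ δ / (2 * (|C'| + 1)) * (|C'| + 1) := by
            refine mul_le_mul_of_nonneg_left ?_ (by positivity)
            linarith [hd k, le_abs_self C']
        _ = δ / 2 := by
            field_simp
    rw [Submodule.coe_sub] at h1 h2
    linarith
  rw [tendsto_iff_norm_sub_tendsto_zero]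
  have := h0.sqrt
  simpa using this

/-- The weights of orthogonal systems of bounded energy do not escape to infinity. -/
theorem exists_one_sub_le_sum (M N : ℕ) (K : ℝ) {δ : ℝ} (hδ : 0 < δ) :
    ∃ J : ℕ, ∀ φ : ℕ → formDomain M N, IsOrthSystem φ →
      (∀ j : ℕ, ‖(φ j : Hil M N)‖ ^ 2 * (j + 1) ≤ 1) → ∑' j, oscEnergy (φ j) ≤ K →
      1 - δ ≤ ∑ j ∈ Finset.range J, ‖(φ j : Hil M N)‖ ^ 2 := by
  obtain ⟨F, c, hc0, hc⟩ := exists_finset_norm_sq_le M N (ε := δ / (2 * (|K| + 1)))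
    (by positivity)
  set S := ∑ b ∈ F, ‖b‖ ^ 2 with hS
  have hS0 : 0 ≤ S := Finset.sum_nonneg fun _ _ => by positivity
  -- Chosen so that the Bessel contribution `c S / (J + 1)` of the tail is at most `δ / 2`.
  obtain ⟨J, hJ⟩ := exists_nat_gt (2 * c * S / δ)
  refine ⟨J, fun φ hφ hr hK => ?_⟩
  have hJ' : c * ((1 / ((J : ℝ) + 1)) * S) ≤ δ / 2 := by
    rw [div_lt_iff₀ hδ] at hJ
    have : c * ((1 / ((J : ℝ) + 1)) * S) = c * S / ((J : ℝ) + 1) := by ring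
    rw [this, div_le_iff₀ (by positivity)]
    nlinarith
  have htail : ∀ n, J ≤ n → ∑ j ∈ Finset.Ico J n, ‖(φ j : Hil M N)‖ ^ 2 ≤ δ := fun n _ => by
    have h1 : ∑ j ∈ Finset.Ico J n, (‖(φ j : Hil M N)‖ ^ 2 + oscEnergy (φ j)) ≤ |K| + 1 := by
      rw [Finset.sum_add_distrib]
      have e1 := sum_le_hasSum (Finset.Ico J n) (fun _ _ => sq_nonneg _) hφ.sum_one
      have e2 := hφ.finite_energy.sum_le_tsum (Finset.Ico J n) fun j _ => oscEnergy_nonneg (φ j)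
      linarith [le_abs_self K]
    have h2 : ∑ j ∈ Finset.Ico J n, ∑ b ∈ F, ‖⟪b, (φ j : Hil M N)⟫_ℂ‖ ^ 2
        ≤ (1 / ((J : ℝ) + 1)) * S := by
      rw [Finset.sum_comm, hS, Finset.mul_sum]
      refine Finset.sum_le_sum fun b _ => ?_
      simp only [norm_inner_symm b]
      -- The ordering of the weights enters here: beyond `J` every squared norm is at most `1 / (J +
      -- 1)`.
      refine sum_norm_inner_sq_le hφ.orthogonal _ (by positivity) (fun j hj => ?_) b
      rw [le_div_iff₀ (by positivity)]
      have hj' : (J : ℝ) ≤ j := by exact_mod_cast (Finset.mem_Ico.mp hj).1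
      refine le_trans ?_ (hr j)
      gcongr
    calc ∑ j ∈ Finset.Ico J n, ‖(φ j : Hil M N)‖ ^ 2
        ≤ ∑ j ∈ Finset.Ico J n, (δ / (2 * (|K| + 1)) * (‖(φ j : Hil M N)‖ ^ 2
          + oscEnergy (φ j)) + c * ∑ b ∈ F, ‖⟪b, (φ j : Hil M N)⟫_ℂ‖ ^ 2) :=
          Finset.sum_le_sum fun j _ => hc (φ j)
      _ = δ / (2 * (|K| + 1)) * ∑ j ∈ Finset.Ico J n, (‖(φ j : Hil M N)‖ ^ 2
          + oscEnergy (φ j)) + c * ∑ j ∈ Finset.Ico J n,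
            ∑ b ∈ F, ‖⟪b, (φ j : Hil M N)⟫_ℂ‖ ^ 2 := by
          rw [Finset.sum_add_distrib, Finset.mul_sum, Finset.mul_sum]
      _ ≤ δ / (2 * (|K| + 1)) * (|K| + 1) + c * ((1 / ((J : ℝ) + 1)) * S) := by gcongr
      _ ≤ δ / 2 + δ / 2 := by
          gcongr
          exact (by field_simp : δ / (2 * (|K| + 1)) * (|K| + 1) = δ / 2).le
      _ = δ := by ring
  have hlim := hφ.sum_one.tendsto_sum_nat
  rw [sub_le_iff_le_add]
  refine le_of_tendsto hlim ((eventually_ge_atTop J).mono fun n hn => ?_)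
  rw [← Finset.sum_range_add_sum_Ico _ hn]
  linarith [htail n hn]

lemma sq_norm_partialD_le (m : Fin M) (ψ : formDomain M N) : ‖partialD m ψ‖ ^ 2 ≤ oscEnergy ψ := by
  have h := Finset.single_le_sum (f := fun m => ‖partialD m ψ‖ ^ 2 + ‖mulPos m ψ‖ ^ 2)
    (fun _ _ => by positivity) (Finset.mem_univ m)
  exact (le_add_of_nonneg_right (sq_nonneg _)).trans h

lemma sq_norm_mulPos_le (m : Fin M) (ψ : formDomain M N) : ‖mulPos m ψ‖ ^ 2 ≤ oscEnergy ψ := by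
  have h := Finset.single_le_sum (f := fun m => ‖partialD m ψ‖ ^ 2 + ‖mulPos m ψ‖ ^ 2)
    (fun _ _ => by positivity) (Finset.mem_univ m)
  exact (le_add_of_nonneg_left (sq_nonneg _)).trans h

lemma norm_ofSq_le {H : Type*} [NormedAddCommGroup H] {f : ℕ → H}
    (hf : Summable fun j => ‖f j‖ ^ 2) {e : ℕ → ℝ} (he : Summable e) (h : ∀ j, ‖f j‖ ^ 2 ≤ e j)
    {K : ℝ} (hK : ∑' j, e j ≤ K) : ‖ofSq f hf‖ ≤ Real.sqrt K := by
  refine Real.le_sqrt_of_sq_le ?_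
  rw [norm_lp_sq]
  exact (hf.tsum_le_tsum h he).trans hK

/-- A strongly convergent family paired with a bounded operator applied to a bounded,
componentwise weakly convergent one. -/
lemma tendsto_tsum_inner_apply {H : Type*} [NormedAddCommGroup H] [InnerProductSpace ℂ H]
    [CompleteSpace H] {a : ι → lp (fun _ : ℕ => H) 2} {a₀ : lp (fun _ : ℕ => H) 2}
    (ha : Tendsto a U (𝓝 a₀)) {b : ι → lp (fun _ : ℕ => H) 2} {C : ℝ} (hC : ∀ k, ‖b k‖ ≤ C)
    {b₀ : lp (fun _ : ℕ => H) 2} (hb : ∀ w, Tendsto (fun k => ⟪w, b k⟫_ℂ) U (𝓝 ⟪w, b₀⟫_ℂ))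
    (A : H →L[ℂ] H) :
    Tendsto (fun k => ∑' j, ⟪a k j, A (b k j)⟫_ℂ) U (𝓝 (∑' j, ⟪a₀ j, A (b₀ j)⟫_ℂ)) := by
  have hle : ∀ k j, ‖A (b k j)‖ ^ 2 ≤ ‖A‖ ^ 2 * ‖b k j‖ ^ 2 := fun k j => by
    rw [← mul_pow]
    gcongr
    exact A.le_opNorm _
  have hs : ∀ k, Summable fun j => ‖A (b k j)‖ ^ 2 := fun k =>
    Summable.of_nonneg_of_le (fun _ => sq_nonneg _) (hle k) ((summable_lp_sq (b k)).mul_left _)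
  refine tendsto_tsum_inner ha (b := fun k => ofSq (fun j => A (b k j)) (hs k))
    (C := Real.sqrt (‖A‖ ^ 2 * C ^ 2)) (fun k => ?_) fun j w => ?_
  · refine norm_ofSq_le _ ((summable_lp_sq (b k)).mul_left _) (hle k) ?_
    rw [tsum_mul_left, ← norm_lp_sq]
    gcongr
    exact hC k
  · exact weak_limit_map A (weak_limit_apply hb j) w

/-- Orthogonal systems of bounded energy have limit points; along them the expectation values
converge and the oscillator energy is lower semicontinuous. -/
theorem exists_limit_orthSystem (U : Ultrafilter ι) {φ : ι → ℕ → formDomain M N}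
    (hφ : ∀ k, IsOrthSystem (φ k))
    (hr : ∀ k, ∀ j : ℕ, ‖(φ k j : Hil M N)‖ ^ 2 * (j + 1) ≤ 1) {K : ℝ}
    (hK : ∀ k, ∑' j, oscEnergy (φ k j) ≤ K) :
    ∃ φ₀ : ℕ → formDomain M N, IsOrthSystem φ₀ ∧
      (∀ A : Hil M N →L[ℂ] Hil M N,
        Tendsto (fun k => ∑' j, ⟪(φ k j : Hil M N), A (φ k j)⟫_ℂ) U
          (𝓝 (∑' j, ⟪(φ₀ j : Hil M N), A (φ₀ j)⟫_ℂ))) ∧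
      (∀ (A : Hil M N →L[ℂ] Hil M N) (m : Fin M),
        Tendsto (fun k => ∑' j, ⟪(φ k j : Hil M N), A (mulPos m (φ k j))⟫_ℂ) U
          (𝓝 (∑' j, ⟪(φ₀ j : Hil M N), A (mulPos m (φ₀ j))⟫_ℂ))) ∧
      ∀ L, Tendsto (fun k => ∑' j, oscEnergy (φ k j)) U (𝓝 L) → ∑' j, oscEnergy (φ₀ j) ≤ L := by
  have hgs : ∀ m k, Summable fun j => ‖partialD m (φ k j)‖ ^ 2 := fun m k =>
    Summable.of_nonneg_of_le (fun _ => sq_nonneg _) (fun j => sq_norm_partialD_le m _)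
      (hφ k).finite_energy
  have hxs : ∀ m k, Summable fun j => ‖mulPos m (φ k j)‖ ^ 2 := fun m k =>
    Summable.of_nonneg_of_le (fun _ => sq_nonneg _) (fun j => sq_norm_mulPos_le m _)
      (hφ k).finite_energy
  set a : ι → lp (fun _ : ℕ => Hil M N) 2 := fun k =>
    ofSq (fun j => (φ k j : Hil M N)) (hφ k).sum_one.summable with ha
  set g : Fin M → ι → lp (fun _ : ℕ => Hil M N) 2 := fun m k =>
    ofSq (fun j => partialD m (φ k j)) (hgs m k) with hg
  set x : Fin M → ι → lp (fun _ : ℕ => Hil M N) 2 := fun m k =>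
    ofSq (fun j => mulPos m (φ k j)) (hxs m k) with hx
  have ha1 : ∀ k, ‖a k‖ ^ 2 = 1 := fun k => (norm_lp_sq _).trans (hφ k).sum_one.tsum_eq
  have hab : ∀ k, ‖a k‖ ≤ 1 := fun k =>
    ((pow_eq_one_iff_of_nonneg (norm_nonneg _) two_ne_zero).mp (ha1 k)).le
  have hgb : ∀ m k, ‖g m k‖ ≤ Real.sqrt K := fun m k =>
    norm_ofSq_le _ (hφ k).finite_energy (fun j => sq_norm_partialD_le m _) (hK k)
  have hxb : ∀ m k, ‖x m k‖ ≤ Real.sqrt K := fun m k =>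
    norm_ofSq_le _ (hφ k).finite_energy (fun j => sq_norm_mulPos_le m _) (hK k)
  obtain ⟨a₀, ha₀⟩ := exists_weak_limit U hab
  choose g₀ hg₀ using fun m => exists_weak_limit U (hgb m)
  choose x₀ hx₀ using fun m => exists_weak_limit U (hxb m)
  have hD : ∀ m j, IsPartial m (a₀ j) (g₀ m j) := fun m j =>
    IsPartial.of_weak_limit (fun k => isPartial_partialD m (φ k j)) (weak_limit_apply ha₀ j)
      (weak_limit_apply (hg₀ m) j)
  have hX : ∀ m j, IsMulPos m (a₀ j) (x₀ m j) := fun m j =>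
    IsMulPos.of_weak_limit (fun k => isMulPos_mulPos m (φ k j)) (weak_limit_apply ha₀ j)
      (weak_limit_apply (hx₀ m) j)
  set φ₀ : ℕ → formDomain M N := fun j => ⟨a₀ j, fun m => ⟨⟨_, hD m j⟩, _, hX m j⟩⟩ with hφ₀
  have hDe : ∀ m j, partialD m (φ₀ j) = g₀ m j := fun m j =>
    (isPartial_partialD m (φ₀ j)).unique (hD m j)
  have hXe : ∀ m j, mulPos m (φ₀ j) = x₀ m j := fun m j =>
    (isMulPos_mulPos m (φ₀ j)).unique (hX m j)
  have hstrong : ∀ j, Tendsto (fun k => (φ k j : Hil M N)) U (𝓝 (a₀ j)) := fun j => by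
    refine tendsto_of_weak_limit (ψ₀ := φ₀ j) (C := 1 + K) (fun k => ?_) (weak_limit_apply ha₀ j)
    have h1 := le_hasSum (hφ k).sum_one j fun _ _ => sq_nonneg _
    have h2 := (hφ k).finite_energy.le_tsum j fun i _ => oscEnergy_nonneg (φ k i)
    linarith [hK k]
  -- No mass is lost: up to δ it sits in the first `J` components, and each of these converges
  -- strongly.
  have hge : 1 ≤ ‖a₀‖ ^ 2 := by
    refine le_of_forall_pos_sub_le fun δ hδ => ?_
    obtain ⟨J, hJ⟩ := exists_one_sub_le_sum M N K hδ
    have h1 : Tendsto (fun k => ∑ j ∈ Finset.range J, ‖(φ k j : Hil M N)‖ ^ 2) U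
        (𝓝 (∑ j ∈ Finset.range J, ‖a₀ j‖ ^ 2)) :=
      tendsto_finsetSum _ fun j _ => (hstrong j).norm.pow 2
    have h2 := ge_of_tendsto h1 (Eventually.of_forall fun k => hJ (φ k) (hφ k) (hr k) (hK k))
    refine h2.trans ?_
    rw [norm_lp_sq]
    exact (summable_lp_sq a₀).sum_le_tsum _ fun _ _ => sq_nonneg _
  -- Weak convergence alone gives this limit. Its nonnegativity yields `‖a₀‖ ≤ 1`; together with
  -- `hge` it vanishes, which is strong convergence.
  have hdist : Tendsto (fun k => ‖a k - a₀‖ ^ 2) U (𝓝 (1 - ‖a₀‖ ^ 2)) := by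
    have h1 : ∀ k, ‖a k - a₀‖ ^ 2 = 1 - 2 * (⟪a₀, a k⟫_ℂ).re + ‖a₀‖ ^ 2 := fun k => by
      rw [@norm_sub_sq ℂ, ha1, inner_re_symm]
      rfl
    have h2 : (⟪a₀, a₀⟫_ℂ).re = ‖a₀‖ ^ 2 := (norm_sq_eq_re_inner (𝕜 := ℂ) a₀).symm
    have h3 := (((Complex.continuous_re.tendsto _).comp (ha₀ a₀)).const_mul 2).const_sub 1
      |>.add_const (‖a₀‖ ^ 2)
    have h4 : 1 - ‖a₀‖ ^ 2 = 1 - 2 * (⟪a₀, a₀⟫_ℂ).re + ‖a₀‖ ^ 2 := by rw [h2]; ring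
    simp only [h1]
    rw [h4]
    exact h3
  have hnorm : ‖a₀‖ ^ 2 = 1 :=
    le_antisymm (sub_nonneg.mp (ge_of_tendsto hdist (Eventually.of_forall fun k => sq_nonneg _)))
      hge
  have hconv : Tendsto a U (𝓝 a₀) := by
    rw [tendsto_iff_norm_sub_tendsto_zero]
    rw [hnorm, sub_self] at hdist
    simpa using hdist.sqrt
  have hosc : ∀ j, oscEnergy (φ₀ j) = ∑ m, (‖g₀ m j‖ ^ 2 + ‖x₀ m j‖ ^ 2) := fun j => by
    simp only [oscEnergy, hDe, hXe]
  have hoscs : ∀ m, Summable fun j => ‖g₀ m j‖ ^ 2 + ‖x₀ m j‖ ^ 2 := fun m =>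
    (summable_lp_sq (g₀ m)).add (summable_lp_sq (x₀ m))
  refine ⟨φ₀, ⟨fun i j hij => ?_, ?_, ?_⟩, fun A => ?_, fun A m => ?_, fun L hL => ?_⟩
  · have h1 : Tendsto (fun k => ⟪(φ k i : Hil M N), (φ k j : Hil M N)⟫_ℂ) U
        (𝓝 ⟪a₀ i, a₀ j⟫_ℂ) := (hstrong i).inner (hstrong j)
    simp only [(hφ _).orthogonal hij] at h1
    exact tendsto_nhds_unique h1 tendsto_const_nhds
  · have := (summable_lp_sq a₀).hasSum
    rwa [← norm_lp_sq, hnorm] at this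
  · simp only [hosc]
    exact summable_sum fun m _ => hoscs m
  · exact tendsto_tsum_inner_apply hconv hab ha₀ A
  · simp only [hXe]
    exact tendsto_tsum_inner_apply hconv (hxb m) (hx₀ m) A
  · have hlow : ∀ {u : ι → lp (fun _ : ℕ => Hil M N) 2} {u₀ : lp (fun _ : ℕ => Hil M N) 2},
        (∀ w, Tendsto (fun k => ⟪w, u k⟫_ℂ) U (𝓝 ⟪w, u₀⟫_ℂ)) →
        Tendsto (fun k => 2 * (⟪u₀, u k⟫_ℂ).re - ‖u₀‖ ^ 2) U (𝓝 (‖u₀‖ ^ 2)) := fun {u u₀} h => by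
      have h2 : (⟪u₀, u₀⟫_ℂ).re = ‖u₀‖ ^ 2 := (norm_sq_eq_re_inner (𝕜 := ℂ) u₀).symm
      have h3 := (((Complex.continuous_re.tendsto _).comp (h u₀)).const_mul 2).sub_const
        (‖u₀‖ ^ 2)
      have h4 : ‖u₀‖ ^ 2 = 2 * (⟪u₀, u₀⟫_ℂ).re - ‖u₀‖ ^ 2 := by rw [h2]; ring
      conv =>
        arg 3
        rw [h4]
      exact h3
    have hsq : ∀ u u₀ : lp (fun _ : ℕ => Hil M N) 2,
        2 * (⟪u₀, u⟫_ℂ).re - ‖u₀‖ ^ 2 ≤ ‖u‖ ^ 2 := fun u u₀ => by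
      have h1 := @norm_sub_sq ℂ _ _ _ _ u₀ u
      have h2 := sq_nonneg ‖u₀ - u‖
      simp only [RCLike.re_to_complex] at h1
      linarith
    have e0 : ∑' j, oscEnergy (φ₀ j) = ∑ m, (‖g₀ m‖ ^ 2 + ‖x₀ m‖ ^ 2) := by
      simp only [hosc]
      rw [Summable.tsum_finsetSum fun m _ => hoscs m]
      refine Finset.sum_congr rfl fun m _ => ?_
      rw [(summable_lp_sq (g₀ m)).tsum_add (summable_lp_sq (x₀ m)), norm_lp_sq, norm_lp_sq]
    have ek : ∀ k, ∑' j, oscEnergy (φ k j) = ∑ m, (‖g m k‖ ^ 2 + ‖x m k‖ ^ 2) := fun k => by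
      simp only [oscEnergy]
      rw [Summable.tsum_finsetSum fun m _ => (hgs m k).add (hxs m k)]
      refine Finset.sum_congr rfl fun m _ => ?_
      rw [(hgs m k).tsum_add (hxs m k), norm_lp_sq, norm_lp_sq]
      rfl
    rw [e0]
    refine le_of_tendsto_of_tendsto (tendsto_finsetSum Finset.univ fun m _ =>
      (hlow (hg₀ m)).add (hlow (hx₀ m))) hL (Eventually.of_forall fun k => ?_)
    simp only [ek]
    exact Finset.sum_le_sum fun m _ => add_le_add (hsq _ _) (hsq _ _)

end Compactness

/-! ### Existence of an optimizer -/

section Optimizer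

open Filter Topology

variable {M N : ℕ}

/-- The part `∑ₘ ∑ₙ Λₘₙ Tr(σ_z^n xₘ Γ) - ∑ₙ tₙ Tr(σ_x^n Γ)` of the energy. -/
def couplingSum (Λ : Matrix (Fin M) (Fin N) ℝ) (t : Fin N → ℝ) (φ : ℕ → formDomain M N) : ℂ :=
  ∑ m, ∑ n, (Λ m n : ℂ) * ∑' j, ⟪(φ j : Hil M N), sigmaZ M n (mulPos m (φ j))⟫_ℂ
    - ∑ n, (t n : ℂ) * ∑' j, ⟪(φ j : Hil M N), sigmaX M n (φ j)⟫_ℂ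

lemma hamForm_eq (Λ : Matrix (Fin M) (Fin N) ℝ) (t : Fin N → ℝ) (ψ : formDomain M N) :
    hamForm Λ t ψ = (oscEnergy ψ : ℂ)
      + ∑ m, ∑ n, (Λ m n : ℂ) * ⟪(ψ : Hil M N), sigmaZ M n (mulPos m ψ)⟫_ℂ
      - ∑ n, (t n : ℂ) * ⟪(ψ : Hil M N), sigmaX M n ψ⟫_ℂ := by
  rw [hamForm, oscEnergy]
  push_cast
  simp only [inner_self_eq_norm_sq_to_K]
  rfl

lemma IsOrthSystem.tsum_hamForm {φ : ℕ → formDomain M N} (h : IsOrthSystem φ)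
    (Λ : Matrix (Fin M) (Fin N) ℝ) (t : Fin N → ℝ) :
    ∑' j, hamForm Λ t (φ j) = ((∑' j, oscEnergy (φ j) : ℝ) : ℂ) + couplingSum Λ t φ := by
  have h1 := Complex.hasSum_ofReal.mpr h.finite_energy.hasSum
  have h2 : ∀ m n, HasSum (fun j => (Λ m n : ℂ) *
      ⟪(φ j : Hil M N), sigmaZ M n (mulPos m (φ j))⟫_ℂ) _ := fun m n =>
    (h.summable (admissible_inner_op (sigmaZ M n) (mulPos m) (bound_mulPos m))).hasSum.mul_left _
  have h3 : ∀ n, HasSum (fun j => (t n : ℂ) * ⟪(φ j : Hil M N), sigmaX M n (φ j)⟫_ℂ) _ := fun n =>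
    (h.summable (admissible_inner_op (sigmaX M n) (formDomain M N).subtype
      bound_subtype)).hasSum.mul_left _
  have h4 := (h1.add (hasSum_sum fun m (_ : m ∈ Finset.univ) =>
    hasSum_sum fun n (_ : n ∈ Finset.univ) => h2 m n)).sub
    (hasSum_sum fun n (_ : n ∈ Finset.univ) => h3 n)
  simp only [hamForm_eq]
  rw [couplingSum, ← add_sub_assoc]
  exact h4.tsum_eq

/-- The Hamiltonian is bounded from below relative to the oscillator energy. -/
lemma exists_oscEnergy_le (Λ : Matrix (Fin M) (Fin N) ℝ) (t : Fin N → ℝ) :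
    ∃ C : ℝ, ∀ ψ : formDomain M N,
      oscEnergy ψ / 2 ≤ (hamForm Λ t ψ).re + C * ‖(ψ : Hil M N)‖ ^ 2 := by
  set L : Fin M → ℝ := fun m => ∑ n, |Λ m n| * ‖sigmaZ M n‖ with hL
  set T : ℝ := ∑ n, |t n| * ‖sigmaX M n‖ with hT
  refine ⟨(∑ m, L m ^ 2) / 2 + T, fun ψ => ?_⟩
  set a := ‖(ψ : Hil M N)‖ with ha
  have hop : ∀ (A : Hil M N →L[ℂ] Hil M N) (χ : Hil M N),
      ‖⟪(ψ : Hil M N), A χ⟫_ℂ‖ ≤ ‖A‖ * (a * ‖χ‖) := fun A χ =>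
    calc ‖⟪(ψ : Hil M N), A χ⟫_ℂ‖ ≤ a * ‖A χ‖ := norm_inner_le_norm _ _
      _ ≤ a * (‖A‖ * ‖χ‖) := by gcongr; exact A.le_opNorm _
      _ = _ := by ring
  have h1 : ‖∑ m, ∑ n, (Λ m n : ℂ) * ⟪(ψ : Hil M N), sigmaZ M n (mulPos m ψ)⟫_ℂ‖
      ≤ ∑ m, (‖mulPos m ψ‖ ^ 2 / 2 + L m ^ 2 / 2 * a ^ 2) := by
    refine (norm_sum_le _ _).trans (Finset.sum_le_sum fun m _ => ?_)
    calc ‖∑ n, (Λ m n : ℂ) * ⟪(ψ : Hil M N), sigmaZ M n (mulPos m ψ)⟫_ℂ‖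
        ≤ ∑ n, |Λ m n| * ‖sigmaZ M n‖ * (a * ‖mulPos m ψ‖) := by
          refine (norm_sum_le _ _).trans (Finset.sum_le_sum fun n _ => ?_)
          rw [norm_mul, Complex.norm_real, Real.norm_eq_abs, mul_assoc]
          gcongr
          exact hop _ _
      _ = L m * (a * ‖mulPos m ψ‖) := by rw [hL, Finset.sum_mul]
      -- Young's inequality, leaving only half of `‖x_m ψ‖²` to be absorbed by the oscillator
      -- energy.
      _ ≤ _ := by nlinarith [sq_nonneg (‖mulPos m ψ‖ - L m * a)]
  have h2 : ‖∑ n, (t n : ℂ) * ⟪(ψ : Hil M N), sigmaX M n ψ⟫_ℂ‖ ≤ T * a ^ 2 := by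
    rw [hT, Finset.sum_mul]
    refine (norm_sum_le _ _).trans (Finset.sum_le_sum fun n _ => ?_)
    rw [norm_mul, Complex.norm_real, Real.norm_eq_abs, mul_assoc, sq]
    gcongr
    exact hop _ _
  have h3 : ∑ m, ‖mulPos m ψ‖ ^ 2 ≤ oscEnergy ψ :=
    Finset.sum_le_sum fun m _ => le_add_of_nonneg_left (sq_nonneg _)
  have h4 : ∑ m, (‖mulPos m ψ‖ ^ 2 / 2 + L m ^ 2 / 2 * a ^ 2)
      = (∑ m, ‖mulPos m ψ‖ ^ 2) / 2 + (∑ m, L m ^ 2) / 2 * a ^ 2 := by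
    rw [Finset.sum_add_distrib, ← Finset.sum_mul, Finset.sum_div, Finset.sum_div]
  have h5 := neg_le_of_abs_le (Complex.abs_re_le_norm
    (∑ m, ∑ n, (Λ m n : ℂ) * ⟪(ψ : Hil M N), sigmaZ M n (mulPos m ψ)⟫_ℂ))
  have h6 := le_of_abs_le (Complex.abs_re_le_norm
    (∑ n, (t n : ℂ) * ⟪(ψ : Hil M N), sigmaX M n ψ⟫_ℂ))
  rw [hamForm_eq, Complex.sub_re, Complex.add_re, Complex.ofReal_re]
  linarith

lemma IsOrthSystem.tsum_oscEnergy_le {φ : ℕ → formDomain M N} (h : IsOrthSystem φ)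
    {Λ : Matrix (Fin M) (Fin N) ℝ} {t : Fin N → ℝ} {C : ℝ}
    (hC : ∀ ψ : formDomain M N,
      oscEnergy ψ / 2 ≤ (hamForm Λ t ψ).re + C * ‖(ψ : Hil M N)‖ ^ 2) :
    (∑' j, oscEnergy (φ j)) / 2 ≤ (∑' j, hamForm Λ t (φ j)).re + C := by
  have h1 := Complex.hasSum_re (h.summable (admissible_hamForm Λ t)).hasSum
  have h2 := h1.add (h.sum_one.mul_left C)
  rw [mul_one] at h2
  exact hasSum_le (fun j => hC (φ j)) (h.finite_energy.hasSum.div_const 2) h2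

/-- The pure state of the trial vector, written as an orthogonal system padded with zeros. -/
lemma exists_density_constraints {σ : Fin N → ℝ} (hσ : ∀ n, σ n ∈ Set.Icc (-1 : ℝ) 1)
    (ξ : Fin M → ℝ) : ∃ Γ ∈ densityMatrices M N, magnetization Γ = σ ∧ displacement Γ = ξ := by
  obtain ⟨ψ, h1, hm, hd⟩ := exists_trial_state hσ ξ
  set φ : ℕ → formDomain M N := fun j => if j = 0 then ψ else 0 with hφ
  have h0 : φ 0 = ψ := if_pos rfl
  have hj : ∀ j, j ≠ 0 → φ j = 0 := fun j h => if_neg h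
  have hs : IsOrthSystem φ := {
    orthogonal := fun i j hij => by
      by_cases hi : i = 0
      · simp only [hj j (fun h => hij (hi.trans h.symm)), Submodule.coe_zero, inner_zero_right]
      · simp only [hj i hi, Submodule.coe_zero, inner_zero_left]
    sum_one := by
      have := hasSum_single (f := fun j => ‖(φ j : Hil M N)‖ ^ 2) 0 fun j h => by simp [hj j h]
      simpa [h0, h1] using this
    finite_energy := (hasSum_single 0 fun j h => by simp [hj j h, oscEnergy]).summable }
  obtain ⟨Γ, hΓ, htr⟩ := hs.exists_density
  have hsingle : ∀ q : formDomain M N → ℂ, Admissible q → formTrace q Γ = q ψ := fun q hq => by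
    have hq0 : q 0 = 0 := by simpa using hq.apply_smul 0 0
    rw [htr q hq, tsum_eq_single 0 fun j h => by rw [hj j h, hq0], h0]
  refine ⟨Γ, hΓ, funext fun n => ?_, funext fun m => ?_⟩
  · rw [magnetization, hsingle _ (admissible_magForm n), hm, Complex.ofReal_re]
  · rw [displacement, hsingle _ (admissible_dispForm m), hd, Complex.ofReal_re]

/-- The energy attains its minimum under the constraints. -/
theorem exists_minimizer (Λ : Matrix (Fin M) (Fin N) ℝ) (t : Fin N → ℝ) {σ : Fin N → ℝ}
    (hσ : ∀ n, σ n ∈ Set.Icc (-1 : ℝ) 1) (ξ : Fin M → ℝ) :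
    ∃ Γ₀ ∈ densityMatrices M N, magnetization Γ₀ = σ ∧ displacement Γ₀ = ξ ∧
      ∀ Γ ∈ densityMatrices M N, magnetization Γ = σ → displacement Γ = ξ →
        energy Λ t Γ₀ ≤ energy Λ t Γ := by
  set S : Set ℝ := {e | ∃ Γ ∈ densityMatrices M N,
    magnetization Γ = σ ∧ displacement Γ = ξ ∧ e = energy Λ t Γ} with hS
  obtain ⟨C, hC⟩ := exists_oscEnergy_le Λ t
  have hne : S.Nonempty := by
    obtain ⟨Γ, hΓ, h1, h2⟩ := exists_density_constraints hσ ξ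
    exact ⟨_, Γ, hΓ, h1, h2, rfl⟩
  have hbdd : BddBelow S := by
    refine ⟨-C, ?_⟩
    rintro e ⟨Γ, hΓ, -, -, rfl⟩
    obtain ⟨φ, hφ, -, htr⟩ := exists_orthSystem hΓ
    have h1 := hφ.tsum_oscEnergy_le hC
    have h2 : 0 ≤ ∑' j, oscEnergy (φ j) := tsum_nonneg fun j => oscEnergy_nonneg _
    rw [energy, htr _ (admissible_hamForm Λ t)]
    linarith
  obtain ⟨u, hanti, hu, huS⟩ := exists_seq_tendsto_sInf hne hbdd
  choose Γ hΓ hmag hdisp hE using huS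
  choose φ hφ hr htr using fun k => exists_orthSystem (hΓ k)
  -- The minimizing sequence of values is antitone, so the first value bounds all the energies.
  have hK : ∀ k, ∑' j, oscEnergy (φ k j) ≤ 2 * (u 0 + C) := fun k => by
    have h1 := (hφ k).tsum_oscEnergy_le hC
    rw [← htr k _ (admissible_hamForm Λ t)] at h1
    have h2 : u k ≤ u 0 := hanti (Nat.zero_le k)
    rw [hE k, energy] at h2
    linarith
  obtain ⟨φ₀, hφ₀, hA, hAX, hosc⟩ := exists_limit_orthSystem (hyperfilter ℕ) hφ hr hK
  obtain ⟨Γ₀, hΓ₀, htr₀⟩ := hφ₀.exists_density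
  have hmag₀ : magnetization Γ₀ = σ := by
    funext n
    have h1 : ∀ k, ∑' j, ⟪(φ k j : Hil M N), sigmaZ M n (φ k j)⟫_ℂ
        = formTrace (magForm n) (Γ k) := fun k => (htr k _ (admissible_magForm n)).symm
    have h2 := (Complex.continuous_re.tendsto _).comp (hA (sigmaZ M n))
    have h3 : ∀ k, (formTrace (magForm n) (Γ k)).re = σ n := fun k => congrFun (hmag k) n
    simp only [Function.comp_def, h1, h3] at h2
    rw [magnetization, htr₀ _ (admissible_magForm n)]
    exact tendsto_nhds_unique h2 tendsto_const_nhds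
  have hdisp₀ : displacement Γ₀ = ξ := by
    funext m
    have h1 : ∀ k, ∑' j, ⟪(φ k j : Hil M N), mulPos m (φ k j)⟫_ℂ
        = formTrace (dispForm m) (Γ k) := fun k => (htr k _ (admissible_dispForm m)).symm
    have h2 := (Complex.continuous_re.tendsto _).comp (hAX (ContinuousLinearMap.id ℂ _) m)
    have h3 : ∀ k, (formTrace (dispForm m) (Γ k)).re = ξ m := fun k => congrFun (hdisp k) m
    simp only [Function.comp_def, ContinuousLinearMap.id_apply, h1, h3] at h2
    rw [displacement, htr₀ _ (admissible_dispForm m)]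
    exact tendsto_nhds_unique h2 tendsto_const_nhds
  have hcoup : Tendsto (fun k => couplingSum Λ t (φ k)) (hyperfilter ℕ)
      (𝓝 (couplingSum Λ t φ₀)) :=
    (tendsto_finsetSum _ fun m _ => tendsto_finsetSum _ fun n _ =>
      (hAX (sigmaZ M n) m).const_mul _).sub
      (tendsto_finsetSum _ fun n _ => (hA (sigmaX M n)).const_mul _)
  have hle : energy Λ t Γ₀ ≤ sInf S := by
    have h1 := (hu.mono_left Nat.hyperfilter_le_atTop).sub
      ((Complex.continuous_re.tendsto _).comp hcoup)
    -- The oscillator energy is total energy minus coupling. Both converge, so it has a limit to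
    -- which lower semicontinuity applies.
    have h2 : ∀ k, u k - (couplingSum Λ t (φ k)).re = ∑' j, oscEnergy (φ k j) := fun k => by
      rw [hE k, energy, htr k _ (admissible_hamForm Λ t), (hφ k).tsum_hamForm, Complex.add_re,
        Complex.ofReal_re, add_sub_cancel_right]
    simp only [Function.comp_def, h2] at h1
    have h3 := hosc _ h1
    rw [energy, htr₀ _ (admissible_hamForm Λ t), hφ₀.tsum_hamForm, Complex.add_re,
      Complex.ofReal_re]
    linarith
  exact ⟨Γ₀, hΓ₀, hmag₀, hdisp₀, fun Γ' hΓ' h1 h2 =>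
    hle.trans (csInf_le hbdd ⟨Γ', hΓ', h1, h2, rfl⟩)⟩

end Optimizer

end Dicke

end

theorem theorem3p12 (M N : ℕ) (Λ : Matrix (Fin M) (Fin N) ℝ) (t : Fin N → ℝ) (ht : t ≠ 0)
    (σ : Fin N → ℝ) (hσ : ∀ n, σ n ∈ Set.Icc (-1 : ℝ) 1) (ξ : Fin M → ℝ) :
    ∃ Γ ∈ Dicke.densityMatrices M N,
      Dicke.magnetization Γ = σ ∧ Dicke.displacement Γ = ξ ∧
      Dicke.liebFunctional Λ t σ ξ = (Dicke.energy Λ t Γ : EReal) := by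
  obtain ⟨Γ, hΓ, h1, h2, hmin⟩ := Dicke.exists_minimizer Λ t hσ ξ
  refine ⟨Γ, hΓ, h1, h2, le_antisymm (sInf_le ⟨Γ, hΓ, h1, h2, rfl⟩) (le_sInf ?_)⟩
  rintro _ ⟨Γ', hΓ', h1', h2', rfl⟩
  exact EReal.coe_le_coe_iff.mpr (hmin Γ' hΓ' h1' h2')
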